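/- Let $n\ge 1$ and let $\alpha=(\alpha_2,\alpha_3,\dots)$ be a finitely supported sequence of non-negative integers. A *minimal factorization of type $\alpha$* of the $n$-cycle $(1\,2\,\dots\,n)$ is a sequence of cycles $\sigma_1,\dots,\sigma_m\in S_n$ of lengths at least $2$ with $\sigma_m\cdots\sigma_1=(1\,2\,\dots\,n)$ (products are composed from right to left), containing exactly $\alpha_j$ cycles of length $j$ for each $j\ge2$, where $\sum_{j\ge2}(j-1)\alpha_j=n-1$. Two factorizations are *equivalent* if one is obtained from the other by repeatedly interchanging neighbouring factors that commute. Let $\mathcal T_{n,\alpha}$ be the set of undirected plane trees, rooted at a leaf (considered up to isomorphism of rooted plane trees), that have $2n$ leaves (vertices of degree $1$, the root included), $\alpha_j$ vertices of degree $2j$ for each $j\ge 2$, and no other vertices. *The plane graph of a product.* To $\sigma_m\cdots\sigma_1$ associate the following directed graph with a counterclockwise order of the edges at each vertex. Its vertices are leaves $t_1,\dots,t_n,h_1,\dots,h_n$ and one vertex for each factor $\sigma_i$. For each $k$ there is a directed path of edges labelled $k$ which starts at $t_k$, passes through the vertices of those factors that move $k$, in the order $\sigma_1,\sigma_2,\dots$,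 and ends at $h_k$. At the vertex of a factor $(k_1\,k_2\,\dots\,k_j)$ the counterclockwise order is: outgoing $k_1$, incoming $k_1$, outgoing $k_2$, incoming $k_2$, …, outgoing $k_j$, incoming $k_j$. *Stripping a tree.* Given a tree in $\mathcal T_{n,\alpha}$, label its leaves $h_1,t_1,h_2,t_2,\dots,h_n,t_n$ counterclockwise, starting with the root. Choose, for some $j$, a remaining internal vertex of degree $2j$ with $j$ adjacent $t$-leaves; the labels of these leaves, read counterclockwise around the vertex, form a cycle, which is the next factor (in the order $\sigma_1,\sigma_2,\dots$). Remove the vertex; its edges to leaves are removed, and its edges to other vertices are cut in half, each of the new leaves so created inheriting the label of the leaf that followed the cut edge counterclockwise at the removed vertex. Repeat until no internal vertex is left. **Theorem.** Sending a minimal factorization of type $\alpha$ to the undirected plane graph of its product, rooted at $h_1$, induces a well-defined bijection from the set of equivalence classes of minimal factorizations of type $\alpha$ of $(1\,2\,\dots\,n)$ onto $\mathcal T_{n,\alpha}$. Its inverse is given by stripping: for every tree in $\mathcal T_{n,\alpha}$, whatever choices are made, as long as an internal vertex is left there is one that can be removed, and the factors that have been read off when none is left form a minimal factorization of type $\alpha$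 in the equivalence class that corresponds to the tree. -/

import Mathlib

/-! ### Minimal factorizations of a long cycle, up to commutation -/

/-- The rank `⟨α⟩ = ∑_{j ≥ 2} (j - 1) α_j` (the indices `0` and `1` contribute nothing). -/
def typeRank (α : ℕ →₀ ℕ) : ℕ := α.sum fun j a => (j - 1) * a

/-- The list `[σ₁, …, σₘ]` is a minimal factorization `σₘ ⋯ σ₁` of type `α` of the cycle
`(0 1 … n-1)`: every factor is a cycle (of length at least two), exactly `α j` of them are
`j`-cycles for each `j ≥ 2`, and `⟨α⟩ = n - 1`. The factors are listed in the order in which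
they are applied. -/
structure IsMinimalFactorization (n : ℕ) (α : ℕ →₀ ℕ) (l : List (Equiv.Perm (Fin n))) :
    Prop where
  isCycle : ∀ σ ∈ l, σ.IsCycle
  prod_eq : l.reverse.prod = finRotate n
  type_eq : ∀ j, 2 ≤ j → l.countP (fun σ => σ.support.card = j) = α j
  minimal : typeRank α + 1 = n

/-- Minimal factorizations of type `α` of `(0 1 … n-1)`. -/
abbrev MinimalFactorization (n : ℕ) (α : ℕ →₀ ℕ) : Type :=
  {l : List (Equiv.Perm (Fin n)) // IsMinimalFactorization n α l}

/-- `l'` is obtained from `l` by interchanging two neighbouring factors that commute. -/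
def CommutationMove {n : ℕ} (l l' : List (Equiv.Perm (Fin n))) : Prop :=
  ∃ (a b : List (Equiv.Perm (Fin n))) (σ τ : Equiv.Perm (Fin n)),
    Commute σ τ ∧ l = a ++ σ :: τ :: b ∧ l' = a ++ τ :: σ :: b

/-- Equivalence of factorizations: they differ only in the order of commuting factors. -/
def factorizationSetoid (n : ℕ) (α : ℕ →₀ ℕ) : Setoid (MinimalFactorization n α) where
  r l l' := Relation.EqvGen CommutationMove l.1 l'.1
  iseqv :=
    ⟨fun l => Relation.EqvGen.refl l.1, fun h => Relation.EqvGen.symm _ _ h,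
      fun h h' => Relation.EqvGen.trans _ _ _ h h'⟩

/-- Inequivalent minimal factorizations of type `α`. -/
abbrev InequivalentFactorization (n : ℕ) (α : ℕ →₀ ℕ) : Type :=
  Quotient (factorizationSetoid n α)

/-! ### The directed plane graph of a product of cycles -/

/-- The half-edges of the directed plane graph of the product `σₘ ⋯ σ₁`, `l = [σ₁, …, σₘ]`.
There is one vertex for each factor, and there are leaves `t_k` and `h_k` for each `k`.
`tail k` and `head k` are the half-edges at the leaves `t_k` and `h_k`; `inc i k` and `out i k`
are the incoming and the outgoing half-edge labelled `k` at the vertex of the `i`-th factor,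
where `k` runs through the elements of that cycle. -/
inductive ProductDart {n : ℕ} (l : List (Equiv.Perm (Fin n))) : Type
  | tail (k : Fin n) : ProductDart l
  | head (k : Fin n) : ProductDart l
  | inc (i : Fin l.length) (k : Fin n) (hk : l.get i k ≠ k) : ProductDart l
  | out (i : Fin l.length) (k : Fin n) (hk : l.get i k ≠ k) : ProductDart l

namespace ProductDart

variable {n : ℕ} {l : List (Equiv.Perm (Fin n))}

/-- The next half-edge in counterclockwise order at the same vertex. At the vertex of a cycle
`(k₁ k₂ … kⱼ)` the order is: outgoing `k₁`, incoming `k₁`, outgoing `k₂`, incoming `k₂`, …. -/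
def rot : ProductDart l → ProductDart l
  | tail k => tail k
  | head k => head k
  | out i k hk => inc i k hk
  | inc i k hk => out i (l.get i k) (fun h => hk ((l.get i).injective h))

/-- The directed edges: for each label `k` there is a directed path of edges labelled `k` that
starts at `t_k`, passes through the vertices of the factors that move `k`, in the order in which
they are applied, and ends at `h_k`. -/
inductive Arrow : ProductDart l → ProductDart l → Prop
  | tail_head (k : Fin n) (h : ∀ r, l.get r k = k) : Arrow (tail k) (head k)
  | tail_inc (j : Fin l.length) (k : Fin n) (hj : l.get j k ≠ k)
      (h : ∀ r, r < j → l.get r k = k) : Arrow (tail k) (inc j k hj)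
  | out_inc (i j : Fin l.length) (k : Fin n) (hi : l.get i k ≠ k) (hj : l.get j k ≠ k)
      (hij : i < j) (h : ∀ r, i < r → r < j → l.get r k = k) : Arrow (out i k hi) (inc j k hj)
  | out_head (i : Fin l.length) (k : Fin n) (hi : l.get i k ≠ k)
      (h : ∀ r, i < r → l.get r k = k) : Arrow (out i k hi) (head k)

end ProductDart

/-! ### Plane trees rooted at a leaf -/

/-- A plane tree rooted at a leaf. The root leaf itself is not recorded: `T` describes what hangs
below it, so `node c f` is the vertex adjacent to the root leaf, its further neighbours being the
tops of `f 0, …, f (c - 1)`, in counterclockwise order after the edge to the root. -/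
inductive PlantedTree : Type
  | node (c : ℕ) (f : Fin c → PlantedTree) : PlantedTree

namespace PlantedTree

/-- The number of vertices of degree `d` of the tree, other than the root leaf. A vertex with `c`
children has degree `c + 1`. -/
def vertexCount (d : ℕ) : PlantedTree → ℕ
  | node c f => (if c + 1 = d then 1 else 0) + ∑ i, vertexCount d (f i)

/-- The tree has `2n` leaves (the root is one of them), `α j` vertices of degree `2j` for each
`j ≥ 2`, and no other vertices. -/
structure HasType (n : ℕ) (α : ℕ →₀ ℕ) (T : PlantedTree) : Prop where
  leaves : T.vertexCount 1 + 1 = 2 * n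
  internal : ∀ j, 2 ≤ j → T.vertexCount (2 * j) = α j
  only : ∀ d, T.vertexCount d ≠ 0 → d = 1 ∨ ∃ j, 2 ≤ j ∧ d = 2 * j

/-- The vertices of the tree other than the root leaf: `none` is the top vertex, and
`some ⟨i, v⟩` is the vertex `v` of the `i`-th subtree. -/
def Vertex : PlantedTree → Type
  | node c f => Option (Σ i : Fin c, Vertex (f i))

/-- The neighbour of the root leaf. -/
def top : (T : PlantedTree) → T.Vertex
  | node _ _ => none

/-- The half-edges of the tree. Each vertex `v` other than the root leaf has an edge to its
parent; `up v` is the half of this edge at `v`, and `down v` its half at the parent of `v`. -/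
inductive Dart (T : PlantedTree) : Type
  | up (v : T.Vertex) : Dart T
  | down (v : T.Vertex) : Dart T

/-- The half-edge at the root leaf. -/
def rootDart (T : PlantedTree) : T.Dart := .down T.top

/-- The other half of the same edge. -/
def opp {T : PlantedTree} : T.Dart → T.Dart
  | .up v => .down v
  | .down v => .up v

/-- The half-edges of the `i`-th subtree (the half-edge at its root leaf included) as half-edges
of the whole tree. -/
def liftDart {c : ℕ} {f : Fin c → PlantedTree} (i : Fin c) : (f i).Dart → (node c f).Dart
  | .up v => .up (some ⟨i, v⟩ : Option (Σ i : Fin c, (f i).Vertex))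
  | .down v => .down (some ⟨i, v⟩ : Option (Σ i : Fin c, (f i).Vertex))

/-- The half-edge at the top vertex towards its `i`-th child if `i < c`; the one towards the root
leaf if `i = c`. -/
def topDart (c : ℕ) (f : Fin c → PlantedTree) (i : ℕ) : (node c f).Dart :=
  if h : i < c then liftDart ⟨i, h⟩ (f ⟨i, h⟩).rootDart else .up (node c f).top

open Classical in
/-- The next half-edge in counterclockwise order at the same vertex: the half-edge to the parent
is followed by those to the children in their order, and then by the one to the parent again.
At the root leaf there is only one half-edge. -/
noncomputable def rot : (T : PlantedTree) → T.Dart → T.Dart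
  | node c f, .up none => topDart c f 0
  | node _ _, .down none => .down none
  | node _ f, .up (some ⟨i, v⟩) => liftDart i (rot (f i) (.up v))
  | node c f, .down (some ⟨i, v⟩) =>
    if v = (f i).top then topDart c f (i + 1) else liftDart i (rot (f i) (.down v))

/-- The leaves other than the root leaf, in the counterclockwise order starting from the root. -/
def leaves : (T : PlantedTree) → List T.Vertex
  | node 0 _ => [none]
  | node (c + 1) f => (List.finRange (c + 1)).flatMap fun i =>
      (leaves (f i)).map fun v => (some ⟨i, v⟩ : Option (Σ i : Fin (c + 1), (f i).Vertex))

/-- `T`, with the leaf `h₀` as its root, is the undirected plane graph of the product `σₘ ⋯ σ₁`,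
`l = [σ₁, …, σₘ]`: there is a bijection of the half-edges that respects the counterclockwise order
around every vertex, the edges, and the root. -/
def IsTreeOfProduct {n : ℕ} [NeZero n] (T : PlantedTree) (l : List (Equiv.Perm (Fin n))) : Prop :=
  ∃ φ : ProductDart l ≃ T.Dart,
    (∀ d, φ d.rot = T.rot (φ d)) ∧
    (∀ d d', (d.Arrow d' ∨ d'.Arrow d) ↔ opp (φ d) = φ d') ∧
    φ (.head 0) = T.rootDart

/-! ### Stripping a tree -/

/-- The half-edges at the vertex that carries `d`. -/
def star {T : PlantedTree} (d : T.Dart) : Set T.Dart := {e | ∃ r : ℕ, T.rot^[r] d = e}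

/-- A stage of the stripping procedure: `gone` is the set of half-edges at the vertices that have
been removed, and `lab e k` says that the edge of the half-edge `e` now leads from its vertex to a
`t`-leaf labelled `k` (an original leaf or one created by cutting an edge). Only the half-edges at
the internal vertices that remain matter. -/
structure Stage (n : ℕ) (T : PlantedTree) : Type where
  gone : Set T.Dart
  lab : T.Dart → Fin n → Prop

/-- At the beginning the leaves are labelled `h₀, t₀, h₁, t₁, …` counterclockwise, starting with
the root. The list `T.leaves` omits the root, so `t_k` stands at its place `2k`. -/
def initialStage (n : ℕ) (T : PlantedTree) : Stage n T where
  gone := ∅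
  lab e k := ∃ v, T.leaves[2 * (k : ℕ)]? = some v ∧ opp e = .up v

namespace Stage

variable {n : ℕ} {T : PlantedTree}

/-- The vertex of `d` is an internal vertex that has not been removed yet; for some `j` its degree
is `2j` and it has `j` adjacent `t`-leaves. -/
def Removable (s : Stage n T) (d : T.Dart) : Prop :=
  d ∉ s.gone ∧ T.rot d ≠ d ∧
    ∃ j, (star d).ncard = 2 * j ∧ {e | e ∈ star d ∧ ∃ k, s.lab e k}.ncard = j

/-- `σ` is the cycle formed by the labels of the `t`-leaves adjacent to the vertex of `d`, read
counterclockwise: it sends the label of each of them to the label of the next one, and fixes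
all other labels. -/
def IsFactor (s : Stage n T) (d : T.Dart) (σ : Equiv.Perm (Fin n)) : Prop :=
  (∀ e ∈ star d, ∀ k, s.lab e k →
    ∃ r, 1 ≤ r ∧ s.lab (T.rot^[r] e) (σ k) ∧
      ∀ q, 1 ≤ q → q < r → ∀ k', ¬ s.lab (T.rot^[q] e) k') ∧
  ∀ k, (∀ e ∈ star d, ¬ s.lab e k) → σ k = k

/-- Remove the vertex of `d`. An edge from it to another vertex is cut; the leaf so created at the
other vertex takes the label of the leaf that followed the edge counterclockwise at the removed
vertex. -/
def remove (s : Stage n T) (d : T.Dart) : Stage n T where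
  gone := s.gone ∪ star d
  lab e k := (opp e ∈ star d ∧ s.lab (T.rot (opp e)) k) ∨ (opp e ∉ star d ∧ s.lab e k)

/-- All internal vertices have been removed. -/
def Complete (s : Stage n T) : Prop := ∀ d, T.rot d ≠ d → d ∈ s.gone

/-- `Run s l s'`: removing vertices one after another leads from `s` to `s'`, and the cycles read
off are those of the list `l`, in this order. -/
inductive Run : Stage n T → List (Equiv.Perm (Fin n)) → Stage n T → Prop
  | nil (s : Stage n T) : Run s [] s
  | cons (s s' : Stage n T) (d : T.Dart) (σ : Equiv.Perm (Fin n)) (l : List (Equiv.Perm (Fin n)))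
      (hd : s.Removable d) (hσ : s.IsFactor d σ) (hl : Run (s.remove d) l s') : Run s (σ :: l) s'

end Stage

end PlantedTree

/-! In the plane graph of `σₘ ⋯ σ₁` the walk along a face that starts at the leaf `h_k` first meets
the leaf `t_k`, and the walk from `t_k` first meets `h_l`, where `l` is the image of `k`. Hence the
graph of a factorization of the `n`-cycle is connected and its leaves are in the order
`h₁, t₁, h₂, t₂, …`. Minimality says that it has one more vertex than edges, so it is a tree. Two
adjacent factors that commute are disjoint, since otherwise the tree would have a double edge, so
interchanging them does not change the graph.

Conversely, a tree of type `α` has exactly one orientation that alternates around its vertices and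
starts with an incoming edge at the root. An edge gets the label of the first leaf on its face, and
a potential that increases along the directed edges orders the vertices; the cycles of the labels
at the vertices, in this order, have the given tree as the graph of their product. Any two orders
that respect the directed edges differ by commutations. Stripping can remove a vertex exactly when
all of its predecessors are gone, so every run lists the factors in such an order. -/

/-- A plane map, described by its half-edges: `rot` turns counterclockwise around a vertex, and
`opp` passes to the other half of the edge. The vertices are the cycles of `rot`, the leaves its
fixed points. -/
structure PlaneMap (D : Type*) where
  rot : Equiv.Perm D
  opp : D → D
  opp_opp : ∀ d, opp (opp d) = d

namespace PlaneMap

variable {D D' : Type*} (M : PlaneMap D) {M' : PlaneMap D'}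

theorem opp_injective : Function.Injective M.opp :=
  Function.LeftInverse.injective M.opp_opp

/-- Maps of half-edges that respect the edges and the order around the vertices. -/
structure IsHom (M : PlaneMap D) (M' : PlaneMap D') (g : D → D') : Prop where
  map_rot : ∀ d, g (M.rot d) = M'.rot (g d)
  map_opp : ∀ d, g (M.opp d) = M'.opp (g d)

namespace IsHom

variable {M}

theorem symm {g : D ≃ D'} (hg : IsHom M M' g) : IsHom M' M g.symm where
  map_rot d := by rw [Equiv.symm_apply_eq, hg.map_rot, g.apply_symm_apply]
  map_opp d := by rw [Equiv.symm_apply_eq, hg.map_opp, g.apply_symm_apply]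

theorem comp {D'' : Type*} {M'' : PlaneMap D''} {g : D → D'} {g' : D' → D''}
    (hg' : IsHom M' M'' g') (hg : IsHom M M' g) : IsHom M M'' (g' ∘ g) where
  map_rot d := by rw [Function.comp_apply, hg.map_rot, hg'.map_rot, Function.comp_apply]
  map_opp d := by rw [Function.comp_apply, hg.map_opp, hg'.map_opp, Function.comp_apply]

theorem map_iterate_rot {g : D → D'} (hg : IsHom M M' g) (m : ℕ) (d : D) :
    g (M.rot^[m] d) = M'.rot^[m] (g d) :=
  Function.Semiconj.iterate_right (f := g) hg.map_rot m d

theorem minimalPeriod_eq {g : D → D'} (hg : IsHom M M' g) (hinj : Function.Injective g)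
    (d : D) : Function.minimalPeriod M'.rot (g d) = Function.minimalPeriod M.rot d := by
  refine Function.minimalPeriod_eq_minimalPeriod_iff.2 fun m => ?_
  rw [Function.IsPeriodicPt, Function.IsFixedPt, ← hg.map_iterate_rot, hinj.eq_iff]
  rfl

end IsHom

/-- `M.NextLeaf e z`: the walk along the face that leaves through the half-edge `e` meets its
first leaf at the half-edge `z`. -/
inductive NextLeaf : D → D → Prop
  | arrive (e : D) (h : M.rot (M.opp e) = M.opp e) : NextLeaf e (M.opp e)
  | go (e z : D) (h : M.rot (M.opp e) ≠ M.opp e) (hz : NextLeaf (M.rot (M.opp e)) z) :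
      NextLeaf e z

namespace NextLeaf

variable {M} {e z : D}

theorem unique {z' : D} (h : M.NextLeaf e z) (h' : M.NextLeaf e z') : z = z' := by
  induction h with
  | arrive e he =>
    cases h' with
    | arrive => rfl
    | go _ _ h _ => exact absurd he h
  | go e z he _ ih =>
    cases h' with
    | arrive _ h => exact absurd h he
    | go _ _ _ h => exact ih h

theorem rot_eq (h : M.NextLeaf e z) : M.rot z = z := by
  induction h with
  | arrive _ he => exact he
  | go _ _ _ _ ih => exact ih

theorem map {g : D → D'} (hg : IsHom M M' g) (hfix : ∀ d, M'.rot (g d) = g d → M.rot d = d)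
    (h : M.NextLeaf e z) : M'.NextLeaf (g e) (g z) := by
  induction h with
  | arrive _ he => rw [hg.map_opp]; exact .arrive _ (by rw [← hg.map_opp, ← hg.map_rot, he])
  | go e z he _ ih =>
    refine .go _ _ ?_ ?_ <;> rw [← hg.map_opp, ← hg.map_rot]
    · rw [hg.map_rot]
      exact fun h => he (hfix _ h)
    · exact ih

end NextLeaf

/-- The walk along the face that leaves through `e` meets the leaves of the list `L` and then
continues as if it left through `e'`. -/
def Leads (e : D) (L : List D) (e' : D) : Prop :=
  ∀ L', List.IsChain M.NextLeaf (e' :: L') → List.IsChain M.NextLeaf (e :: (L ++ L'))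

namespace Leads

variable {M} {e e' e'' : D} {L L' : List D}

theorem refl (e : D) : M.Leads e [] e := fun _ h => h

theorem trans (h : M.Leads e L e') (h' : M.Leads e' L' e'') : M.Leads e (L ++ L') e'' :=
  fun L'' h'' => by rw [List.append_assoc]; exact h _ (h' L'' h'')

theorem go (h : M.rot (M.opp e) ≠ M.opp e) : M.Leads e [] (M.rot (M.opp e)) := by
  intro L hL
  cases L with
  | nil => exact List.isChain_singleton _
  | cons z L =>
    rw [List.isChain_cons_cons] at hL
    exact List.isChain_cons_cons.2 ⟨.go _ _ h hL.1, hL.2⟩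

theorem arrive (h : M.rot (M.opp e) = M.opp e) : M.Leads e [M.opp e] (M.opp e) :=
  fun _ hL => List.isChain_cons_cons.2 ⟨.arrive _ h, hL⟩

theorem flatMap {c : ℕ} (e : ℕ → D) (L : Fin c → List D)
    (h : ∀ i : Fin c, M.Leads (e i) (L i) (e (i + 1))) :
    M.Leads (e 0) ((List.finRange c).flatMap L) (e c) := by
  induction c generalizing e with
  | zero => exact refl _
  | succ c ih =>
    rw [List.finRange_succ, List.flatMap_cons, List.flatMap_map]
    exact (h 0).trans (ih (fun j => e (j + 1)) (fun i => L i.succ) fun i => h i.succ)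

end Leads

/-- Every half-edge can be reached from `r`. -/
def IsConnectedFrom (r : D) : Prop :=
  ∀ S : Set D, r ∈ S → (∀ d ∈ S, M.rot d ∈ S) → (∀ d ∈ S, M.opp d ∈ S) → ∀ d, d ∈ S

/-- The vertices of a plane map, which are the cycles of the rotation. -/
abbrev Vertex : Type _ := Quotient (Equiv.Perm.SameCycle.setoid M.rot)

/-- The vertex that carries the half-edge `d`. -/
def vertex (d : D) : M.Vertex := Quotient.mk _ d

theorem vertex_eq_vertex_iff {d d' : D} : M.vertex d = M.vertex d' ↔ M.rot.SameCycle d d' :=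
  Quotient.eq

@[simp] theorem vertex_rot (d : D) : M.vertex (M.rot d) = M.vertex d :=
  M.vertex_eq_vertex_iff.2 (Equiv.Perm.sameCycle_apply_left.2 (.refl _ _))

@[simp] theorem vertex_iterate_rot (m : ℕ) (d : D) : M.vertex (M.rot^[m] d) = M.vertex d := by
  induction m with
  | zero => rfl
  | succ m ih => rw [Function.iterate_succ_apply', vertex_rot, ih]

theorem vertex_eq_vertex_iff_exists_iterate [Finite D] {d d' : D} :
    M.vertex d = M.vertex d' ↔ ∃ m, M.rot^[m] d = d' := by
  refine ⟨fun h => ?_, fun ⟨m, hm⟩ => by rw [← hm, vertex_iterate_rot]⟩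
  obtain ⟨m, hm⟩ := (M.vertex_eq_vertex_iff.1 h).exists_nat_pow_eq
  exact ⟨m, by rwa [Equiv.Perm.iterate_eq_pow]⟩

theorem minimalPeriod_rot [Finite D] (d : D) :
    Function.minimalPeriod M.rot d = {d' | M.vertex d = M.vertex d'}.ncard := by
  have hd : d ∈ Function.periodicPts M.rot := M.rot.injective.mem_periodicPts d
  have : {d' | M.vertex d = M.vertex d'} =
      (fun m => M.rot^[m] d) '' Set.Iio (Function.minimalPeriod M.rot d) := by
    ext d'
    rw [Set.mem_ofPred_eq, vertex_eq_vertex_iff_exists_iterate]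
    constructor
    · rintro ⟨m, rfl⟩
      exact ⟨m % Function.minimalPeriod M.rot d,
        Nat.mod_lt _ (Function.minimalPeriod_pos_of_mem_periodicPts hd),
        Function.iterate_mod_minimalPeriod_eq⟩
    · rintro ⟨m, -, rfl⟩
      exact ⟨m, rfl⟩
  rw [this, Function.iterate_injOn_Iio_minimalPeriod.ncard_image, Set.ncard_Iio_nat]

section Closed

variable {M} [Finite D] {S : Set D} (hrot : ∀ d ∈ S, M.rot d ∈ S)
include hrot

theorem mem_iff_of_vertex_eq {d d' : D} (h : M.vertex d = M.vertex d') : d ∈ S ↔ d' ∈ S := by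
  have : ∀ {d d' : D}, M.vertex d = M.vertex d' → d ∈ S → d' ∈ S := by
    intro d d' h hd
    obtain ⟨m, rfl⟩ := M.vertex_eq_vertex_iff_exists_iterate.1 h
    exact Set.MapsTo.iterate (f := M.rot) hrot m hd
  exact ⟨this h, this h.symm⟩

theorem NextLeaf.mem_iff (hopp : ∀ d ∈ S, M.opp d ∈ S) {e z : D} (h : M.NextLeaf e z) :
    e ∈ S ↔ z ∈ S := by
  have hopp_iff : ∀ d, d ∈ S ↔ M.opp d ∈ S := fun d =>
    ⟨hopp d, fun h => M.opp_opp d ▸ hopp _ h⟩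
  induction h with
  | arrive e _ => exact hopp_iff e
  | go e _ _ _ ih =>
    exact (hopp_iff e).trans ((mem_iff_of_vertex_eq hrot (M.vertex_rot _)).symm.trans ih)

end Closed

/-- A level function of the vertices together with a choice of the half-edges that are `up`, i.e.
point from a vertex of positive level to its unique parent. -/
structure IsLeveling (r : D) (up : D → Prop) (lev : M.Vertex → ℕ) : Prop where
  up_opp : ∀ d, up (M.opp d) ↔ ¬ up d
  lev_eq : ∀ d, up d → lev (M.vertex d) = lev (M.vertex (M.opp d)) + 1
  up_unique : ∀ d d', up d → up d' → M.vertex d = M.vertex d' → d = d'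
  lev_root : lev (M.vertex r) = 0

variable {M} {r : D}

namespace IsLeveling

variable {up : D → Prop} {lev : M.Vertex → ℕ}

theorem not_up_root (h : M.IsLeveling r up lev) : ¬ up r := fun hr => by
  have := h.lev_eq r hr
  rw [h.lev_root] at this
  omega

theorem eq_of_vertex_eq (h : M.IsLeveling r up lev) {d d' : D}
    (hd : M.vertex d = M.vertex d') (ho : M.vertex (M.opp d) = M.vertex (M.opp d')) : d = d' := by
  wlog hup : up d generalizing d d'
  · refine M.opp_injective (this ho ?_ ((h.up_opp d).2 hup))
    rwa [M.opp_opp, M.opp_opp]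
  by_cases hup' : up d'
  · exact h.up_unique _ _ hup hup' hd
  · have h1 := h.lev_eq _ hup
    have h2 := h.lev_eq _ ((h.up_opp d').2 hup')
    rw [M.opp_opp, ← hd, ← ho] at h2
    omega

end IsLeveling

namespace IsConnectedFrom

variable (h : M.IsConnectedFrom r)
include h

/-- The level is the distance to the vertex of `r`. -/
theorem exists_level : ∃ lev : M.Vertex → ℕ, lev (M.vertex r) = 0 ∧
    ∀ w, w ≠ M.vertex r → ∃ d, M.vertex d = w ∧ lev w = lev (M.vertex (M.opp d)) + 1 := by
  let P : ℕ → Set M.Vertex := Nat.rec {M.vertex r} fun _ s =>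
    {w | ∃ d, M.vertex d = w ∧ M.vertex (M.opp d) ∈ s}
  have hP : ∀ w, {m | w ∈ P m}.Nonempty := by
    refine fun w => Quotient.inductionOn w fun d => ?_
    refine h {d | ∃ m, M.vertex d ∈ P m} ⟨0, rfl⟩ ?_ ?_ d
    · rintro d ⟨m, hm⟩
      exact ⟨m, by rwa [vertex_rot]⟩
    · rintro d ⟨m, hm⟩
      exact ⟨m + 1, M.opp d, rfl, by rwa [M.opp_opp]⟩
  refine ⟨fun w => sInf {m | w ∈ P m}, Nat.sInf_eq_zero.2 (.inl rfl), fun w hw => ?_⟩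
  beta_reduce
  have hmem : w ∈ P (sInf {m | w ∈ P m}) := Nat.sInf_mem (hP w)
  generalize hm : sInf {m | w ∈ P m} = m at hmem ⊢
  obtain _ | m := m
  · exact absurd hmem hw
  obtain ⟨d, hd, hd'⟩ := hmem
  refine ⟨d, hd, le_antisymm ?_ (Nat.succ_le_succ (Nat.sInf_le hd'))⟩
  rw [← hm]
  exact Nat.sInf_le ⟨d, hd, Nat.sInf_mem (hP (M.vertex (M.opp d)))⟩

/-- The parent edges of the vertices other than the root are all edges, because there are as many
of the former as of the latter. -/
theorem exists_isLeveling [Finite D] (hcard : 2 * Nat.card M.Vertex = Nat.card D + 2) :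
    ∃ up lev, M.IsLeveling r up lev := by
  classical
  have := Fintype.ofFinite D
  have := Fintype.ofFinite M.Vertex
  obtain ⟨lev, h0, hlev⟩ := h.exists_level
  choose p hp hpl using fun w : {w // w ≠ M.vertex r} => hlev w.1 w.2
  have hne : ∀ w w', p w ≠ M.opp (p w') := by
    intro w w' hw
    have h1 := hpl w
    have h2 := hpl w'
    rw [← hw, hp] at h2
    rw [hw, M.opp_opp, hp] at h1
    omega
  have hp_inj : Function.Injective p := fun a b hab => Subtype.ext (by rw [← hp a, hab, hp])
  have hsurj : Function.Surjective (Sum.elim p (M.opp ∘ p)) := by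
    have hinj : Function.Injective (Sum.elim p (M.opp ∘ p)) :=
      hp_inj.sumElim (M.opp_injective.comp hp_inj) hne
    refine ((Fintype.bijective_iff_injective_and_card _).2 ⟨hinj, ?_⟩).2
    rw [Fintype.card_sum, Fintype.card_subtype_compl, Fintype.card_subtype_eq]
    rw [Nat.card_eq_fintype_card, Nat.card_eq_fintype_card] at hcard
    omega
  refine ⟨(· ∈ Set.range p), lev, fun d => ?_, ?_, ?_, h0⟩
  · obtain ⟨w | w, rfl⟩ := hsurj d
    · exact ⟨fun ⟨w', hw'⟩ => absurd hw' (hne _ _), fun hw => absurd ⟨w, rfl⟩ hw⟩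
    · rw [Sum.elim_inr, Function.comp_apply, M.opp_opp]
      exact ⟨fun _ ⟨w', hw'⟩ => hne _ _ hw', fun _ => ⟨w, rfl⟩⟩
  · rintro _ ⟨w, rfl⟩
    rw [hp, hpl]
  · rintro _ _ ⟨w, rfl⟩ ⟨w', rfl⟩ hw
    rw [hp, hp] at hw
    rw [Subtype.ext hw]

end IsConnectedFrom

end PlaneMap

namespace PlantedTree

open PlaneMap

theorem opp_opp {T : PlantedTree} (x : T.Dart) : opp (opp x) = x := by cases x <;> rfl

theorem opp_up_top (T : PlantedTree) : opp (.up T.top) = T.rootDart := rfl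

theorem rot_rootDart (T : PlantedTree) : T.rot T.rootDart = T.rootDart := by
  cases T; rfl

/-- The map on the half-edges of `node c f` with given values at the two half-edges of the root
edge and given restrictions to the subtrees. -/
def nodeMap {X : Type*} {c : ℕ} {f : Fin c → PlantedTree} (a b : X) (g : ∀ i, (f i).Dart → X) :
    (node c f).Dart → X
  | .up none => b
  | .down none => a
  | .up (some ⟨i, v⟩) => g i (.up v)
  | .down (some ⟨i, v⟩) => g i (.down v)

section Node

variable {c : ℕ} {f : Fin c → PlantedTree}

theorem opp_liftDart (i : Fin c) (x : (f i).Dart) :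
    opp (liftDart (f := f) i x) = liftDart i (opp x) := by cases x <;> rfl

theorem liftDart_inj {i j : Fin c} {x : (f i).Dart} {y : (f j).Dart}
    (h : liftDart (f := f) i x = liftDart j y) : i = j ∧ x ≍ y := by
  cases x <;> cases y <;> simp only [liftDart] at h <;> cases h <;> exact ⟨rfl, .rfl⟩

theorem liftDart_injective (i : Fin c) : Function.Injective (liftDart (f := f) i) :=
  fun _ _ h => eq_of_heq (liftDart_inj h).2

theorem liftDart_ne_rootDart (i : Fin c) (x : (f i).Dart) :
    liftDart i x ≠ (node c f).rootDart := by
  intro h; cases x <;> cases h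

theorem liftDart_ne_up_top (i : Fin c) (x : (f i).Dart) :
    liftDart i x ≠ .up (node c f).top := by
  intro h; cases x <;> cases h

theorem up_top_ne_rootDart : .up (node c f).top ≠ (node c f).rootDart := nofun

theorem dart_cases {P : (node c f).Dart → Prop} (root : P (node c f).rootDart)
    (top : P (.up (node c f).top)) (lift : ∀ i x, P (liftDart i x)) (x) : P x := by
  rcases x with (_ | ⟨i, v⟩) | (_ | ⟨i, v⟩)
  · exact top
  · exact lift i (.up v)
  · exact root
  · exact lift i (.down v)

section nodeMap

variable {X : Type*} (a b : X) (g : ∀ i, (f i).Dart → X)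

@[simp] theorem nodeMap_rootDart : nodeMap a b g (node c f).rootDart = a := rfl

@[simp] theorem nodeMap_up_top : nodeMap a b g (.up (node c f).top) = b := rfl

@[simp] theorem nodeMap_liftDart (i : Fin c) (x) : nodeMap a b g (liftDart i x) = g i x := by
  cases x <;> rfl

end nodeMap

theorem rot_up_top : (node c f).rot (.up (node c f).top) = topDart c f 0 := rfl

theorem rot_liftDart (i : Fin c) {x : (f i).Dart} (hx : x ≠ (f i).rootDart) :
    (node c f).rot (liftDart i x) = liftDart i ((f i).rot x) := by
  cases x with
  | up v => rfl
  | down v => exact if_neg fun h => hx (by rw [h]; rfl)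

theorem rot_liftDart_rootDart (i : Fin c) :
    (node c f).rot (liftDart i (f i).rootDart) = topDart c f (i + 1) := if_pos rfl

theorem topDart_of_lt (i : Fin c) : topDart c f i = liftDart i (f i).rootDart := by
  simp [topDart]

theorem topDart_self : topDart c f c = .up (node c f).top := by
  simp [topDart]

theorem rot_topDart {i : ℕ} (hi : i < c) :
    (node c f).rot (topDart c f i) = topDart c f (i + 1) := by
  rw [topDart_of_lt ⟨i, hi⟩, rot_liftDart_rootDart]

theorem topDart_injOn : Set.InjOn (topDart c f) (Set.Iic c) := by
  intro i (hi : i ≤ c) j (hj : j ≤ c) h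
  rcases hi.lt_or_eq with hi | rfl <;> rcases hj.lt_or_eq with hj | rfl
  · rw [topDart_of_lt ⟨i, hi⟩, topDart_of_lt ⟨j, hj⟩] at h
    exact congrArg Fin.val (liftDart_inj h).1
  · rw [topDart_of_lt ⟨i, hi⟩, topDart_self] at h
    exact absurd h (liftDart_ne_up_top _ _)
  · rw [topDart_of_lt ⟨j, hj⟩, topDart_self] at h
    exact absurd h.symm (liftDart_ne_up_top _ _)
  · rfl

theorem topDart_ne_rootDart (i : ℕ) : topDart c f i ≠ (node c f).rootDart := by
  unfold topDart
  split
  · exact liftDart_ne_rootDart _ _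
  · exact up_top_ne_rootDart

/-- The half-edges of `node c f`: the two halves of the root edge and those of the subtrees. -/
def dartEquiv (c : ℕ) (f : Fin c → PlantedTree) :
    (node c f).Dart ≃ Option (Option (Σ i, (f i).Dart)) where
  toFun := nodeMap none (some none) fun i x => some (some ⟨i, x⟩)
  invFun
    | none => (node c f).rootDart
    | some none => .up (node c f).top
    | some (some ⟨i, x⟩) => liftDart i x
  left_inv x := by induction x using dart_cases <;> simp
  right_inv x := by rcases x with _ | _ | ⟨i, x⟩ <;> simp

end Node

instance finite_dart (T : PlantedTree) : Finite T.Dart := by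
  induction T with
  | node c f ih => exact Finite.of_equiv _ (dartEquiv c f).symm

theorem rot_surjective (T : PlantedTree) : Function.Surjective T.rot := by
  induction T with
  | node c f ih =>
    have htop : ∀ i ≤ c, ∃ y, (node c f).rot y = topDart c f i := by
      rintro (_ | i) hi
      · exact ⟨_, rot_up_top⟩
      · exact ⟨_, rot_topDart hi⟩
    intro x
    induction x using dart_cases with
    | root => exact ⟨_, rot_rootDart _⟩
    | top => exact topDart_self (f := f) ▸ htop c le_rfl
    | lift i x =>
      by_cases hx : x = (f i).rootDart
      · rw [hx, ← topDart_of_lt]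
        exact htop i i.2.le
      · obtain ⟨y, rfl⟩ := ih i x
        exact ⟨liftDart i y, rot_liftDart i fun hy => hx (by rw [hy, rot_rootDart])⟩

/-- The plane map of the half-edges of `T`. -/
noncomputable def planeMap (T : PlantedTree) : PlaneMap T.Dart where
  rot := Equiv.ofBijective T.rot (Finite.surjective_iff_bijective.1 T.rot_surjective)
  opp := opp
  opp_opp := opp_opp

@[simp] theorem coe_rot_planeMap (T : PlantedTree) : ⇑T.planeMap.rot = T.rot := rfl

@[simp] theorem opp_planeMap (T : PlantedTree) : T.planeMap.opp = opp := rfl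

theorem rot_injective (T : PlantedTree) : Function.Injective T.rot := T.planeMap.rot.injective

/-- The map `g` sends the half-edges of `T` to those of a plane map such that edges and, except at
the root leaf, the counterclockwise orders around the vertices are respected: `T` is a branch that
may hang at an arbitrary vertex. -/
structure IsBranch {D : Type*} (M : PlaneMap D) {T : PlantedTree} (g : T.Dart → D) : Prop where
  opp_apply : ∀ x, M.opp (g x) = g (opp x)
  rot_apply : ∀ x, x ≠ T.rootDart → M.rot (g x) = g (T.rot x)

namespace IsBranch

variable {D : Type*} {M : PlaneMap D}

protected theorem id (T : PlantedTree) : IsBranch T.planeMap (id : T.Dart → T.Dart) :=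
  ⟨fun _ => rfl, fun _ _ => rfl⟩

theorem isHom {T : PlantedTree} {g : T.Dart → D} (hg : IsBranch M g)
    (hroot : M.rot (g T.rootDart) = g T.rootDart) : IsHom T.planeMap M g where
  map_rot x := by
    by_cases hx : x = T.rootDart
    · rw [hx, hroot, coe_rot_planeMap, rot_rootDart]
    · exact (hg.rot_apply x hx).symm
  map_opp x := (hg.opp_apply x).symm

variable {c : ℕ} {f : Fin c → PlantedTree} {g : (node c f).Dart → D} (hg : IsBranch M g)
include hg

theorem lift (i : Fin c) : IsBranch M (g ∘ liftDart i) where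
  opp_apply x := by simp only [Function.comp_apply, hg.opp_apply, opp_liftDart]
  rot_apply x hx := by
    simp only [Function.comp_apply, hg.rot_apply _ (liftDart_ne_rootDart i x), rot_liftDart i hx]

theorem rot_topDart {i : ℕ} (hi : i < c) :
    M.rot (g (topDart c f i)) = g (topDart c f (i + 1)) := by
  rw [hg.rot_apply _ (topDart_ne_rootDart i), PlantedTree.rot_topDart hi]

theorem iterate_rot_up_top {i : ℕ} (hi : i ≤ c) :
    M.rot^[i + 1] (g (.up (node c f).top)) = g (topDart c f i) := by
  induction i with
  | zero => exact hg.rot_apply _ up_top_ne_rootDart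
  | succ i ih => rw [Function.iterate_succ_apply', ih (by omega), hg.rot_topDart hi]

theorem isPeriodicPt_up_top : Function.IsPeriodicPt M.rot (c + 1) (g (.up (node c f).top)) := by
  rw [Function.IsPeriodicPt, Function.IsFixedPt, hg.iterate_rot_up_top le_rfl, topDart_self]

theorem minimalPeriod_up_top (hinj : Function.Injective g) :
    Function.minimalPeriod M.rot (g (.up (node c f).top)) = c + 1 := by
  have hper := hg.isPeriodicPt_up_top
  refine le_antisymm (hper.minimalPeriod_le (by omega)) ?_
  obtain ⟨m, hm⟩ := Nat.exists_eq_succ_of_ne_zero (hper.minimalPeriod_pos (by omega)).ne'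
  by_contra! h
  have htop : g (topDart c f m) = g (topDart c f c) := by
    rw [← hg.iterate_rot_up_top (by omega), ← Nat.succ_eq_add_one m, ← hm,
      Function.iterate_minimalPeriod, topDart_self]
  have := topDart_injOn (Set.mem_Iic.2 (by omega)) (Set.mem_Iic.2 le_rfl) (hinj htop)
  omega

omit hg

theorem tree_unique {T T' : PlantedTree} {g : T.Dart → D} {g' : T'.Dart → D}
    (hg : IsBranch M g) (hg' : IsBranch M g') (hinj : Function.Injective g)
    (hinj' : Function.Injective g') (h : g T.rootDart = g' T'.rootDart) : T = T' := by
  induction T generalizing T' with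
  | node c f ih =>
    obtain ⟨c', f'⟩ := T'
    have htop : g (.up (node c f).top) = g' (.up (node c' f').top) := by
      rw [← opp_opp (.up (node c f).top), ← opp_opp (.up (node c' f').top), opp_up_top, opp_up_top,
        ← hg.opp_apply, ← hg'.opp_apply, h]
    obtain rfl : c = c' := by
      have h1 := hg.minimalPeriod_up_top hinj
      rw [htop, hg'.minimalPeriod_up_top hinj'] at h1
      omega
    congr 1
    funext i
    refine ih i (hg.lift i) (hg'.lift i) (hinj.comp (liftDart_injective i))
      (hinj'.comp (liftDart_injective i)) ?_
    rw [Function.comp_apply, Function.comp_apply, ← topDart_of_lt, ← topDart_of_lt,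
      ← hg.iterate_rot_up_top i.2.le, ← hg'.iterate_rot_up_top i.2.le, htop]

end IsBranch

variable {D : Type*} {M : PlaneMap D}

theorem eq_of_isHom {T T' : PlantedTree} (g : T.Dart ≃ D) (g' : T'.Dart ≃ D)
    (hg : IsHom T.planeMap M g) (hg' : IsHom T'.planeMap M g')
    (h : g T.rootDart = g' T'.rootDart) : T = T' :=
  IsBranch.tree_unique ⟨fun x => (hg.map_opp x).symm, fun x _ => (hg.map_rot x).symm⟩
    ⟨fun x => (hg'.map_opp x).symm, fun x _ => (hg'.map_rot x).symm⟩ g.injective g'.injective h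

/-! ### Trees from plane maps -/

theorem isBranch_nodeMap {c : ℕ} {f : Fin c → PlantedTree} {d : D} {g : ∀ i, (f i).Dart → D}
    (hg : ∀ i, IsBranch M (g i)) (hroot : ∀ i, g i (f i).rootDart = M.rot^[i + 1] (M.opp d))
    (hper : M.rot^[c + 1] (M.opp d) = M.opp d) : IsBranch M (nodeMap d (M.opp d) g) := by
  have htop : ∀ i ≤ c, nodeMap d (M.opp d) g (topDart c f i) = M.rot^[i + 1] (M.opp d) := by
    intro i hi
    rcases hi.lt_or_eq with hi | rfl
    · rw [topDart_of_lt ⟨i, hi⟩, nodeMap_liftDart, hroot]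
    · rw [topDart_self, nodeMap_up_top, hper]
  refine ⟨fun x => ?_, fun x hx => ?_⟩
  · induction x using dart_cases with
    | root => rfl
    | top => rw [opp_up_top, nodeMap_rootDart, nodeMap_up_top, M.opp_opp]
    | lift i x => rw [opp_liftDart, nodeMap_liftDart, nodeMap_liftDart, (hg i).opp_apply]
  · induction x using dart_cases with
    | root => exact absurd rfl hx
    | top => rw [rot_up_top, htop 0 (by omega)]; rfl
    | lift i x =>
      by_cases h : x = (f i).rootDart
      · rw [h, rot_liftDart_rootDart, htop _ i.2, nodeMap_liftDart, hroot,
          ← Function.iterate_succ_apply' M.rot]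
      · rw [rot_liftDart i h, nodeMap_liftDart, nodeMap_liftDart, (hg i).rot_apply _ h]

/-- The map is unfolded away from the root; this ends because the level increases. -/
theorem exists_isBranch [Finite D] {r : D} {up : D → Prop} {lev : M.Vertex → ℕ}
    (hl : M.IsLeveling r up lev) {d : D} (hd : ¬ up d) :
    ∃ (T : PlantedTree) (g : T.Dart → D), IsBranch M g ∧ g T.rootDart = d ∧
      ∀ x ≠ T.rootDart, lev (M.vertex d) < lev (M.vertex (g x)) := by
  obtain ⟨N, hN⟩ := (Set.finite_range lev).bddAbove
  induction hm : N - lev (M.vertex d) using Nat.strong_induction_on generalizing d with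
  | _ m ih =>
  subst hm
  have hup : up (M.opp d) := (hl.up_opp d).2 hd
  have hlev : lev (M.vertex (M.opp d)) = lev (M.vertex d) + 1 := by
    rw [hl.lev_eq _ hup, M.opp_opp]
  have hle : lev (M.vertex (M.opp d)) ≤ N := hN ⟨_, rfl⟩
  obtain ⟨c, hc⟩ := Nat.exists_eq_succ_of_ne_zero
    (Function.minimalPeriod_pos_of_mem_periodicPts (M.rot.injective.mem_periodicPts (M.opp d))).ne'
  have hper : M.rot^[c + 1] (M.opp d) = M.opp d := by
    have := Function.iterate_minimalPeriod (f := M.rot) (x := M.opp d)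
    rwa [hc] at this
  have hchild : ∀ i : Fin c, ¬ up (M.rot^[i + 1] (M.opp d)) := by
    intro i hi
    refine Function.not_isPeriodicPt_of_pos_of_lt_minimalPeriod (f := M.rot) (x := M.opp d)
      (n := i + 1) (by omega) (by omega) (hl.up_unique _ _ hi hup ?_)
    rw [vertex_iterate_rot]
  choose f g hg hroot hlt using fun i : Fin c => ih _
    (by rw [vertex_iterate_rot, hlev]; omega) (hchild i) rfl
  refine ⟨node c f, nodeMap d (M.opp d) g, isBranch_nodeMap hg hroot hper, rfl, fun x hx => ?_⟩
  induction x using dart_cases with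
  | root => exact absurd rfl hx
  | top => rw [nodeMap_up_top]; omega
  | lift i x =>
    rw [nodeMap_liftDart]
    by_cases h : x = (f i).rootDart
    · rw [h, hroot, vertex_iterate_rot]; omega
    · have := hlt i x h
      rw [vertex_iterate_rot] at this
      omega

/-- The half-edges that are hit only once form a set that is closed under `rot` and `opp`. -/
theorem bijective_of_isHom {T : PlantedTree} {g : T.Dart → D} {r : D} (hg : IsHom T.planeMap M g)
    (hM : M.IsConnectedFrom r) (hroot : ∀ x, g x = r ↔ x = T.rootDart) : Function.Bijective g := by
  refine ⟨fun x y hxy => ?_, ?_⟩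
  · refine hM {d | ∀ x y, g x = d → g y = d → x = y} (fun x y hx hy => ?_) ?_ ?_ (g x) x y rfl
      hxy.symm
    · rw [(hroot x).1 hx, (hroot y).1 hy]
    · intro d hd x y hx hy
      obtain ⟨x, rfl⟩ := T.planeMap.rot.surjective x
      obtain ⟨y, rfl⟩ := T.planeMap.rot.surjective y
      rw [hg.map_rot, M.rot.apply_eq_iff_eq] at hx hy
      rw [hd x y hx hy]
    · intro d hd x y hx hy
      refine T.planeMap.opp_injective (hd _ _ ?_ ?_) <;> rw [hg.map_opp]
      · rw [hx, M.opp_opp]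
      · rw [hy, M.opp_opp]
  · refine hM (Set.range g) ⟨T.rootDart, (hroot _).2 rfl⟩ ?_ ?_
    · rintro _ ⟨x, rfl⟩
      exact ⟨_, hg.map_rot x⟩
    · rintro _ ⟨x, rfl⟩
      exact ⟨_, hg.map_opp x⟩

theorem exists_equiv_isHom [Finite D] {r : D} (hM : M.IsConnectedFrom r) (hr : M.rot r = r)
    (hcard : 2 * Nat.card M.Vertex = Nat.card D + 2) :
    ∃ (T : PlantedTree) (g : T.Dart ≃ D), IsHom T.planeMap M g ∧ g T.rootDart = r := by
  obtain ⟨up, lev, hl⟩ := hM.exists_isLeveling hcard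
  obtain ⟨T, g, hg, rfl, hlt⟩ := exists_isBranch hl hl.not_up_root
  have hhom := hg.isHom hr
  refine ⟨T, .ofBijective g (bijective_of_isHom hhom hM fun x => ⟨fun hx => ?_, ?_⟩), hhom, rfl⟩
  · by_contra hne
    exact (hlt x hne).ne (by rw [hx])
  · rintro rfl
    rfl

end PlantedTree

namespace PlantedTree

open PlaneMap

/-! ### Leaves and degrees -/

section Leaves

/-- A vertex of the `i`-th subtree as a vertex of the whole tree. -/
def liftVertex {c : ℕ} {f : Fin c → PlantedTree} (i : Fin c) (v : (f i).Vertex) :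
    (node c f).Vertex :=
  (some ⟨i, v⟩ : Option (Σ i : Fin c, (f i).Vertex))

theorem leaves_node_zero (f : Fin 0 → PlantedTree) : (node 0 f).leaves = [(node 0 f).top] := rfl

theorem leaves_node {c : ℕ} (hc : c ≠ 0) (f : Fin c → PlantedTree) :
    (node c f).leaves =
      (List.finRange c).flatMap fun i => (f i).leaves.map (liftVertex i) := by
  cases c with
  | zero => exact absurd rfl hc
  | succ c => rfl

namespace IsBranch

variable {D : Type*} {M : PlaneMap D} {c : ℕ} {f : Fin c → PlantedTree} {g : (node c f).Dart → D}

theorem leads_rootDart (hg : IsBranch M g) (hinj : Function.Injective g) (hc : c ≠ 0) :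
    M.Leads (g (node c f).rootDart) [] (g (topDart c f 0)) := by
  have hrot : M.rot (M.opp (g (node c f).rootDart)) = g (topDart c f 0) := by
    rw [hg.opp_apply]
    exact hg.rot_apply _ up_top_ne_rootDart
  rw [← hrot]
  refine .go ?_
  rw [hrot, hg.opp_apply, ← opp_up_top, opp_opp, ← topDart_self]
  exact fun h => hc.symm (topDart_injOn (Set.mem_Iic.2 c.zero_le) (Set.mem_Iic.2 le_rfl) (hinj h))

theorem leads_liftDart_up_top (hg : IsBranch M g) (hinj : Function.Injective g) (i : Fin c) :
    M.Leads (g (liftDart i (.up (f i).top))) [] (g (topDart c f (i + 1))) := by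
  have hopp : M.opp (g (liftDart i (.up (f i).top))) = g (topDart c f i) := by
    rw [hg.opp_apply, opp_liftDart, opp_up_top, topDart_of_lt]
  rw [← hg.rot_topDart i.2, ← hopp]
  refine .go ?_
  rw [hopp, hg.rot_topDart i.2]
  exact fun h => absurd
    (topDart_injOn (Set.mem_Iic.2 i.2) (Set.mem_Iic.2 i.2.le) (hinj h)) (Nat.succ_ne_self i)

theorem leads {T : PlantedTree} {g : T.Dart → D} (hg : IsBranch M g)
    (hinj : Function.Injective g) :
    M.Leads (g T.rootDart) (T.leaves.map fun v => g (.up v)) (g (.up T.top)) := by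
  induction T with
  | node c f ih =>
    rcases eq_or_ne c 0 with rfl | hc
    · have hopp : M.opp (g (node 0 f).rootDart) = g (.up (node 0 f).top) := hg.opp_apply _
      have := Leads.arrive (M := M) (e := g (node 0 f).rootDart) (by
        rw [hopp, hg.rot_apply _ up_top_ne_rootDart, rot_up_top, topDart_self])
      rwa [hopp] at this
    · have hchild : ∀ i : Fin c, M.Leads (g (topDart c f i))
          ((f i).leaves.map fun v => g (liftDart i (.up v))) (g (topDart c f (i + 1))) := by
        intro i
        have := (ih i (hg.lift i) (hinj.comp (liftDart_injective i))).trans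
          (hg.leads_liftDart_up_top hinj i)
        rwa [List.append_nil, Function.comp_apply, ← topDart_of_lt] at this
      have := (hg.leads_rootDart hinj hc).trans (.flatMap (fun i => g (topDart c f i)) _ hchild)
      rw [topDart_self] at this
      simp only [leaves_node hc, List.map_flatMap, List.map_map]
      exact this

end IsBranch

/-- The half-edges at the leaves, in counterclockwise order, starting with the root. -/
def leafDarts (T : PlantedTree) : List T.Dart := T.rootDart :: T.leaves.map .up

theorem isChain_leafDarts (T : PlantedTree) :
    List.IsChain T.planeMap.NextLeaf (T.leafDarts ++ [T.rootDart]) :=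
  (IsBranch.id T).leads Function.injective_id [T.rootDart]
    (List.isChain_cons_cons.2 ⟨.arrive _ T.rot_rootDart, List.isChain_singleton _⟩)

theorem mem_leafDarts {T : PlantedTree} {x : T.Dart} (hx : T.rot x = x) : x ∈ T.leafDarts := by
  induction T with
  | node c f ih =>
    induction x using dart_cases with
    | root => exact List.mem_cons_self
    | top =>
      rw [rot_up_top, ← topDart_self] at hx
      obtain rfl : 0 = c := topDart_injOn (Set.mem_Iic.2 c.zero_le) (Set.mem_Iic.2 le_rfl) hx
      simp [leafDarts, leaves_node_zero]
    | lift i x =>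
      by_cases h : x = (f i).rootDart
      · rw [h, rot_liftDart_rootDart, ← topDart_of_lt] at hx
        exact absurd (topDart_injOn (Set.mem_Iic.2 i.2) (Set.mem_Iic.2 i.2.le) hx)
          (Nat.succ_ne_self i)
      · rw [rot_liftDart i h] at hx
        obtain ⟨v, hv, rfl⟩ := List.mem_map.1
          ((List.mem_cons.1 (ih i (liftDart_injective i hx))).resolve_left h)
        refine List.mem_cons_of_mem _ (List.mem_map.2 ⟨liftVertex i v, ?_, rfl⟩)
        rw [leaves_node (Fin.pos i).ne']
        exact List.mem_flatMap.2 ⟨i, List.mem_finRange i, List.mem_map_of_mem hv⟩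

theorem vertexCount_node (d c : ℕ) (f : Fin c → PlantedTree) :
    (node c f).vertexCount d = (if c + 1 = d then 1 else 0) + ∑ i, (f i).vertexCount d := by
  rw [vertexCount]

theorem length_leaves (T : PlantedTree) : T.leaves.length = T.vertexCount 1 := by
  induction T with
  | node c f ih =>
    rcases eq_or_ne c 0 with rfl | hc
    · simp [leaves_node_zero, vertexCount_node]
    · simp [leaves_node hc, vertexCount_node, List.length_flatMap, ih, Fin.sum_univ_def, hc]

end Leaves

section Degrees

noncomputable instance fintypeDart (T : PlantedTree) : Fintype T.Dart := Fintype.ofFinite _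

theorem sum_dart {c : ℕ} {f : Fin c → PlantedTree} (F : (node c f).Dart → ℕ) :
    ∑ x, F x = F (node c f).rootDart + (F (.up (node c f).top) + ∑ i, ∑ x, F (liftDart i x)) := by
  rw [← (dartEquiv c f).symm.sum_comp, Fintype.sum_option, Fintype.sum_option, Fintype.sum_sigma]
  rfl

open Classical in
theorem IsBranch.sum_minimalPeriod {D : Type*} {M : PlaneMap D} {T : PlantedTree}
    {g : T.Dart → D} (hg : IsBranch M g) (hinj : Function.Injective g) (k : ℕ) :
    (∑ x, if x ≠ T.rootDart ∧ Function.minimalPeriod M.rot (g x) = k then 1 else 0) =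
      k * T.vertexCount k := by
  induction T with
  | node c f ih =>
    have hroot : ∀ i : Fin c,
        Function.minimalPeriod M.rot (g (liftDart i (f i).rootDart)) = c + 1 := by
      intro i
      rw [← topDart_of_lt, ← hg.iterate_rot_up_top i.2.le, Function.minimalPeriod_apply_iterate,
        hg.minimalPeriod_up_top hinj]
      exact Function.mk_mem_periodicPts c.succ_pos hg.isPeriodicPt_up_top
    have hsub : ∀ i : Fin c, (∑ x, if liftDart i x ≠ (node c f).rootDart ∧
        Function.minimalPeriod M.rot (g (liftDart i x)) = k then 1 else 0) =
        (if c + 1 = k then 1 else 0) + k * (f i).vertexCount k := by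
      intro i
      rw [← ih i (hg.lift i) (hinj.comp (liftDart_injective i)),
        ← Fintype.sum_ite_eq' (f i).rootDart fun _ => if c + 1 = k then 1 else 0,
        ← Finset.sum_add_distrib]
      refine Finset.sum_congr rfl fun x _ => ?_
      by_cases hx : x = (f i).rootDart
      · simp [hx, hroot, liftDart_ne_rootDart]
      · simp [hx, liftDart_ne_rootDart]
    rw [sum_dart, Finset.sum_congr rfl fun i _ => hsub i, Finset.sum_add_distrib,
      hg.minimalPeriod_up_top hinj, ← Finset.mul_sum, vertexCount_node, mul_add]
    by_cases hk : c + 1 = k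
    · simp [hk, up_top_ne_rootDart]
      omega
    · simp [hk]

theorem card_minimalPeriod (T : PlantedTree) (k : ℕ) :
    Nat.card {x : T.Dart // Function.minimalPeriod T.rot x = k} =
      k * T.vertexCount k + if k = 1 then 1 else 0 := by
  classical
  have hroot : Function.minimalPeriod T.rot T.rootDart = 1 :=
    Function.minimalPeriod_eq_one_iff_isFixedPt.2 T.rot_rootDart
  rw [← (IsBranch.id T).sum_minimalPeriod Function.injective_id k, Nat.card_eq_fintype_card,
    Fintype.card_subtype, Finset.card_filter,
    ← Fintype.sum_ite_eq' T.rootDart fun _ => if k = 1 then 1 else 0, ← Finset.sum_add_distrib]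
  refine Finset.sum_congr rfl fun x _ => ?_
  by_cases hx : x = T.rootDart
  · simp [hx, hroot, eq_comm]
  · simp [hx]

/-- The degrees of the vertices other than the root leaf. -/
def degrees : PlantedTree → Multiset ℕ
  | node c f => (c + 1) ::ₘ ∑ i, degrees (f i)

theorem count_degrees (T : PlantedTree) (d : ℕ) : T.degrees.count d = T.vertexCount d := by
  induction T with
  | node c f ih =>
    simp only [degrees, Multiset.count_cons, Multiset.count_sum', ih, vertexCount_node, add_comm,
      eq_comm]

/-- There are as many edges as vertices other than the root leaf. -/
theorem sum_degrees (T : PlantedTree) : T.degrees.sum + 1 = 2 * T.degrees.card := by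
  induction T with
  | node c f ih =>
    have hsum : (∑ i, (f i).degrees).sum = ∑ i, (f i).degrees.sum :=
      map_sum Multiset.sumAddMonoidHom _ _
    have hchild : ∑ i, (f i).degrees.sum + c = 2 * ∑ i, (f i).degrees.card := by
      rw [Finset.mul_sum, ← Finset.sum_congr rfl fun i _ => ih i, Finset.sum_add_distrib]
      simp
    rw [degrees, Multiset.sum_cons, Multiset.card_cons, hsum, Multiset.card_sum]
    omega

end Degrees

theorem HasType.degrees_eq {n : ℕ} {α : ℕ →₀ ℕ} {T : PlantedTree} (h : T.HasType n α) :
    T.degrees = Multiset.replicate (T.vertexCount 1) 1 +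
      ∑ j ∈ α.support with 2 ≤ j, Multiset.replicate (α j) (2 * j) := by
  ext d
  rw [Multiset.count_add, Multiset.count_sum', count_degrees]
  simp only [Multiset.count_replicate]
  by_cases hd : d = 1 ∨ ∃ j, 2 ≤ j ∧ d = 2 * j
  · obtain rfl | ⟨j, hj, rfl⟩ := hd
    · rw [if_pos rfl, Finset.sum_eq_zero fun j _ => if_neg (by omega), add_zero]
    · rw [if_neg (by omega), zero_add, h.internal j hj, Finset.sum_eq_single j, if_pos rfl]
      · exact fun i _ hi => if_neg (by omega)
      · intro hj'
        rw [if_pos rfl]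
        by_contra hα
        exact hj' (Finset.mem_filter.2 ⟨Finsupp.mem_support_iff.2 hα, hj⟩)
  · rw [not_not.1 (mt (h.only d) hd), if_neg fun h1 => hd (.inl h1.symm), zero_add]
    refine (Finset.sum_eq_zero fun j hj => if_neg fun hj' => hd (.inr ⟨j, ?_, hj'.symm⟩)).symm
    exact (Finset.mem_filter.1 hj).2

theorem HasType.typeRank_add_one {n : ℕ} {α : ℕ →₀ ℕ} {T : PlantedTree} (h : T.HasType n α) :
    typeRank α + 1 = n := by
  have hleaves := h.leaves
  have hsum := T.sum_degrees
  have hrank : typeRank α + ∑ j ∈ α.support with 2 ≤ j, α j =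
      ∑ j ∈ α.support with 2 ≤ j, α j * j := by
    have : typeRank α = ∑ j ∈ α.support with 2 ≤ j, (j - 1) * α j := by
      refine (Finset.sum_filter_of_ne fun j _ hj => ?_).symm
      by_contra! h2
      exact hj (mul_eq_zero_of_left (by omega) _)
    rw [this, ← Finset.sum_add_distrib]
    refine Finset.sum_congr rfl fun j hj => ?_
    obtain ⟨i, rfl⟩ := Nat.exists_eq_add_of_le (Finset.mem_filter.1 hj).2
    rw [show 2 + i - 1 = i + 1 by omega]
    ring
  have hmap : (∑ j ∈ α.support with 2 ≤ j, Multiset.replicate (α j) (2 * j)).sum =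
      2 * ∑ j ∈ α.support with 2 ≤ j, α j * j := by
    refine (map_sum Multiset.sumAddMonoidHom _ _).trans ?_
    rw [Finset.mul_sum]
    refine Finset.sum_congr rfl fun j _ => ?_
    rw [Multiset.coe_sumAddMonoidHom, Multiset.sum_replicate, smul_eq_mul]
    ring
  rw [h.degrees_eq, Multiset.sum_add, hmap, Multiset.card_add, Multiset.card_sum] at hsum
  simp only [Multiset.sum_replicate, Multiset.card_replicate, smul_eq_mul, mul_one] at hsum
  omega

/-! ### Alternating colourings and potentials -/

/-- Incoming half-edges have the colour `true`, outgoing ones the colour `false`: the halves of an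
edge have different colours, and the colours alternate around each vertex that is not a leaf. -/
structure IsAlternating {T : PlantedTree} (col : T.Dart → Bool) : Prop where
  col_opp : ∀ x, col (opp x) = !col x
  col_rot : ∀ x, T.rot x ≠ x → col (T.rot x) = !col x

/-- All vertices that are not leaves have even degree. -/
def IsEven (T : PlantedTree) : Prop := ∀ d, T.vertexCount d ≠ 0 → d = 1 ∨ Even d

theorem IsEven.child {c : ℕ} {f : Fin c → PlantedTree} (h : (node c f).IsEven) (i : Fin c) :
    (f i).IsEven := fun d hd => h d <| by
  have := Finset.single_le_sum (f := fun i => (f i).vertexCount d) (fun _ _ => Nat.zero_le _)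
    (Finset.mem_univ i)
  rw [vertexCount_node]
  omega

theorem IsEven.odd {c : ℕ} {f : Fin c → PlantedTree} (h : (node c f).IsEven) (hc : c ≠ 0) :
    Odd c := by
  have hd : (node c f).vertexCount (c + 1) ≠ 0 := by
    rw [vertexCount_node, if_pos rfl]
    omega
  exact Nat.not_even_iff_odd.1 (Nat.even_add_one.1 ((h _ hd).resolve_left (by omega)))

theorem IsEven.exists_isAlternating {T : PlantedTree} (hT : T.IsEven) (b : Bool) :
    ∃ col : T.Dart → Bool, IsAlternating col ∧ col T.rootDart = b := by
  induction T generalizing b with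
  | node c f ih =>
    choose col hcol hroot using fun i : Fin c => ih i (hT.child i) (b ^^ decide (Odd (i : ℕ)))
    have htop : c ≠ 0 → ∀ i ≤ c, nodeMap b (!b) col (topDart c f i) = (b ^^ decide (Odd i)) := by
      intro h0 i hi
      rcases hi.lt_or_eq with hi | rfl
      · rw [topDart_of_lt ⟨i, hi⟩, nodeMap_liftDart, hroot]
      · simp [topDart_self, hT.odd h0]
    refine ⟨nodeMap b (!b) col, ⟨fun x => ?_, fun x hx => ?_⟩, rfl⟩
    · induction x using dart_cases with
      | root => rfl
      | top => simp [opp_up_top]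
      | lift i x => simp [opp_liftDart, (hcol i).col_opp]
    · induction x using dart_cases with
      | root => exact absurd (rot_rootDart _) hx
      | top =>
        have h0 : c ≠ 0 := by
          rintro rfl
          exact hx (by rw [rot_up_top, ← topDart_self])
        simp [rot_up_top, htop h0]
      | lift i x =>
        by_cases h : x = (f i).rootDart
        · rw [h, rot_liftDart_rootDart, htop (Fin.pos i).ne' _ i.2, nodeMap_liftDart, hroot]
          by_cases hi : Odd (i : ℕ) <;> simp [hi, Nat.odd_add_one]
        · rw [rot_liftDart i h] at hx ⊢
          rw [nodeMap_liftDart, nodeMap_liftDart, (hcol i).col_rot]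
          exact fun h' => hx (by rw [h'])

theorem exists_height {A : Type*} [AddGroup A] (T : PlantedTree) (w : T.Dart → A)
    (hw : ∀ x, w (opp x) = -w x) (a : A) :
    ∃ ht : T.Dart → A, (∀ x, ht (T.rot x) = ht x) ∧ (∀ x, ht (opp x) = ht x + w x) ∧
      ht T.rootDart = a := by
  induction T generalizing a with
  | node c f ih =>
    choose ht hrot hopp hroot using fun i : Fin c => ih i (w ∘ liftDart i)
      (fun x => by simp only [Function.comp_apply, ← hw, opp_liftDart])
      (a + w (node c f).rootDart)
    have htop : ∀ i, nodeMap a (a + w (node c f).rootDart) ht (topDart c f i) =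
        a + w (node c f).rootDart := by
      intro i
      by_cases hi : i < c
      · rw [topDart_of_lt ⟨i, hi⟩, nodeMap_liftDart, hroot]
      · rw [topDart, dif_neg hi, nodeMap_up_top]
    refine ⟨nodeMap a (a + w (node c f).rootDart) ht, fun x => ?_, fun x => ?_, rfl⟩
    · induction x using dart_cases with
      | root => rw [rot_rootDart]
      | top => rw [rot_up_top, htop, nodeMap_up_top]
      | lift i x =>
        by_cases h : x = (f i).rootDart
        · rw [h, rot_liftDart_rootDart, htop, nodeMap_liftDart, hroot]
        · rw [rot_liftDart i h, nodeMap_liftDart, nodeMap_liftDart, hrot]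
    · induction x using dart_cases with
      | root => rfl
      | top =>
        rw [opp_up_top, nodeMap_rootDart, nodeMap_up_top, ← opp_up_top, hw, neg_add_cancel_right]
      | lift i x => simp [opp_liftDart, hopp]

end PlantedTree

namespace ProductDart

variable {n : ℕ} {l : List (Equiv.Perm (Fin n))}

/-! ### The plane map of a product -/

theorem Arrow.right_unique {d a b : ProductDart l} (h : Arrow d a) (h' : Arrow d b) : a = b := by
  cases h with
  | tail_head k h =>
    cases h' with
    | tail_head => rfl
    | tail_inc j _ hj _ => exact absurd (h j) hj
  | tail_inc j k hj h =>
    cases h' with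
    | tail_head _ h' => exact absurd (h' j) hj
    | tail_inc j' _ hj' h' =>
      rcases lt_trichotomy j j' with hlt | rfl | hlt
      · exact absurd (h' j hlt) hj
      · rfl
      · exact absurd (h j' hlt) hj'
  | out_inc i j k hi hj hij h =>
    cases h' with
    | out_inc _ j' _ _ hj' hij' h' =>
      rcases lt_trichotomy j j' with hlt | rfl | hlt
      · exact absurd (h' j hij hlt) hj
      · rfl
      · exact absurd (h j' hij' hlt) hj'
    | out_head _ _ _ h' => exact absurd (h' j hij) hj
  | out_head i k hi h =>
    cases h' with
    | out_inc _ j' _ _ hj' hij' h' => exact absurd (h j' hij') hj'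
    | out_head => rfl

theorem Arrow.left_unique {d a b : ProductDart l} (h : Arrow a d) (h' : Arrow b d) : a = b := by
  cases h with
  | tail_head k h =>
    cases h' with
    | tail_head => rfl
    | out_head i _ hi _ => exact absurd (h i) hi
  | tail_inc j k hj h =>
    cases h' with
    | tail_inc => rfl
    | out_inc i _ _ hi _ hij _ => exact absurd (h i hij) hi
  | out_inc i j k hi hj hij h =>
    cases h' with
    | tail_inc _ _ _ h' => exact absurd (h' i hij) hi
    | out_inc i' _ _ hi' _ hij' h' =>
      rcases lt_trichotomy i i' with hlt | rfl | hlt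
      · exact absurd (h i' hlt hij') hi'
      · rfl
      · exact absurd (h' i hlt hij) hi
  | out_head i k hi h =>
    cases h' with
    | tail_head _ h' => exact absurd (h' i) hi
    | out_head i' _ hi' h' =>
      rcases lt_trichotomy i i' with hlt | rfl | hlt
      · exact absurd (h i' hlt) hi'
      · rfl
      · exact absurd (h' i hlt) hi

theorem Arrow.not_trans {a b d : ProductDart l} (h : Arrow a b) (h' : Arrow b d) : False := by
  cases h <;> cases h'

/-- `Before d p k`: the half-edge `d` starts the edge of the path of `k` at which this path has
passed the factors of index less than `p`, and no others. -/
inductive Before : ProductDart l → ℕ → Fin n → Prop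
  | tail (k : Fin n) (p : ℕ) (h : ∀ r : Fin l.length, (r : ℕ) < p → l.get r k = k) :
      Before (tail k) p k
  | out (i : Fin l.length) (k : Fin n) (hi : l.get i k ≠ k) (p : ℕ) (hip : (i : ℕ) < p)
      (h : ∀ r : Fin l.length, i < r → (r : ℕ) < p → l.get r k = k) : Before (out i k hi) p k

/-- `After d p k`: the half-edge `d` ends the edge of the path of `k` at which this path still has
to pass the factors of index at least `p`, and no others. -/
inductive After : ProductDart l → ℕ → Fin n → Prop
  | head (k : Fin n) (p : ℕ) (h : ∀ r : Fin l.length, p ≤ (r : ℕ) → l.get r k = k) :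
      After (head k) p k
  | inc (i : Fin l.length) (k : Fin n) (hi : l.get i k ≠ k) (p : ℕ) (hip : p ≤ (i : ℕ))
      (h : ∀ r : Fin l.length, p ≤ (r : ℕ) → r < i → l.get r k = k) : After (inc i k hi) p k

theorem Before.arrow {d d' : ProductDart l} {p : ℕ} {k : Fin n} (h : Before d p k)
    (h' : After d' p k) : Arrow d d' := by
  cases h with
  | tail _ _ h =>
    cases h' with
    | head _ _ h' => exact .tail_head k fun r => (lt_or_ge (r : ℕ) p).elim (h r) (h' r)
    | inc j _ hj _ hpj h' =>
      exact .tail_inc j k hj fun r hr => (lt_or_ge (r : ℕ) p).elim (h r) (h' r · hr)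
  | out i _ hi _ hip h =>
    cases h' with
    | head _ _ h' =>
      exact .out_head i k hi fun r hr => (lt_or_ge (r : ℕ) p).elim (h r hr) (h' r)
    | inc j _ hj _ hpj h' =>
      exact .out_inc i j k hi hj (hip.trans_le hpj) fun r hr hr' =>
        (lt_or_ge (r : ℕ) p).elim (h r hr) (h' r · hr')

theorem before_tail (k : Fin n) : Before (tail k : ProductDart l) 0 k :=
  .tail k 0 fun _ hr => absurd hr (Nat.not_lt_zero _)

theorem before_out (i : Fin l.length) (k : Fin n) (hk) :
    Before (out i k hk : ProductDart l) (i + 1) k :=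
  .out i k hk _ (Nat.lt_succ_self _) fun _ hr hr' => absurd hr (Nat.lt_succ_iff.1 hr').not_gt

theorem after_head (k : Fin n) : After (head k : ProductDart l) l.length k :=
  .head k _ fun r hr => absurd r.2 hr.not_gt

theorem after_inc (i : Fin l.length) (k : Fin n) (hk) : After (inc i k hk : ProductDart l) i k :=
  .inc i k hk _ le_rfl fun _ hr hr' => absurd hr' hr.not_gt

theorem Before.succ {d : ProductDart l} {k : Fin n} {p : Fin l.length} (h : Before d p k)
    (hp : l.get p k = k) : Before d (p + 1) k := by
  have hlt : ∀ r : Fin l.length, (r : ℕ) < p + 1 → (r : ℕ) < p ∨ r = p := fun r hr =>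
    (Nat.lt_succ_iff_lt_or_eq.1 hr).imp_right Fin.ext
  cases h with
  | tail _ _ h => exact .tail k _ fun r hr => (hlt r hr).elim (h r) (· ▸ hp)
  | out i _ hi _ hip h =>
    exact .out i k hi _ (by omega) fun r hr hr' => (hlt r hr').elim (h r hr) (· ▸ hp)

theorem After.pred {d : ProductDart l} {k : Fin n} {p : Fin l.length} (h : After d (p + 1) k)
    (hp : l.get p k = k) : After d p k := by
  have hle : ∀ r : Fin l.length, (p : ℕ) ≤ r → (p : ℕ) + 1 ≤ r ∨ r = p := fun r hr =>
    hr.lt_or_eq.imp_right fun h => Fin.ext h.symm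
  cases h with
  | head _ _ h => exact .head k _ fun r hr => (hle r hr).elim (h r) (· ▸ hp)
  | inc i _ hi _ hip h =>
    exact .inc i k hi _ (by omega) fun r hr hr' => (hle r hr).elim (h r · hr') (· ▸ hp)

theorem exists_before {p : ℕ} (hp : p ≤ l.length) (k : Fin n) :
    ∃ d : ProductDart l, Before d p k := by
  induction p with
  | zero => exact ⟨_, before_tail k⟩
  | succ p ih =>
    by_cases hk : l.get ⟨p, hp⟩ k = k
    · obtain ⟨d, hd⟩ := ih (by omega)
      exact ⟨d, hd.succ (p := ⟨p, hp⟩) hk⟩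
    · exact ⟨_, before_out ⟨p, hp⟩ k hk⟩

theorem exists_after {p : ℕ} (hp : p ≤ l.length) (k : Fin n) :
    ∃ d : ProductDart l, After d p k := by
  induction hp using Nat.decreasingInduction with
  | of_succ p hp ih =>
    by_cases hk : l.get ⟨p, hp⟩ k = k
    · obtain ⟨d, hd⟩ := ih
      exact ⟨d, hd.pred (p := ⟨p, hp⟩) hk⟩
    · exact ⟨_, after_inc ⟨p, hp⟩ k hk⟩
  | self => exact ⟨_, after_head k⟩

theorem exists_arrow (d : ProductDart l) : ∃ d', Arrow d d' ∨ Arrow d' d := by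
  cases d with
  | tail k => exact (exists_after (Nat.zero_le _) k).imp fun _ h => .inl ((before_tail k).arrow h)
  | head k => exact (exists_before le_rfl k).imp fun _ h => .inr (h.arrow (after_head k))
  | inc i k hk =>
    exact (exists_before i.2.le k).imp fun _ h => .inr (h.arrow (after_inc i k hk))
  | out i k hk => exact (exists_after i.2 k).imp fun _ h => .inl ((before_out i k hk).arrow h)

/-- The other half of the same edge. -/
noncomputable def opp (d : ProductDart l) : ProductDart l := (exists_arrow d).choose

theorem arrow_opp (d : ProductDart l) : Arrow d d.opp ∨ Arrow d.opp d :=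
  (exists_arrow d).choose_spec

theorem opp_eq_iff {d d' : ProductDart l} : d.opp = d' ↔ Arrow d d' ∨ Arrow d' d := by
  refine ⟨fun h => h ▸ arrow_opp d, fun h => ?_⟩
  rcases arrow_opp d with h1 | h1 <;> rcases h with h2 | h2
  · exact h1.right_unique h2
  · exact (h2.not_trans h1).elim
  · exact (h1.not_trans h2).elim
  · exact h1.left_unique h2

theorem Arrow.opp_eq {d d' : ProductDart l} (h : Arrow d d') : d.opp = d' := opp_eq_iff.2 (.inl h)

theorem Arrow.opp_eq' {d d' : ProductDart l} (h : Arrow d d') : d'.opp = d := opp_eq_iff.2 (.inr h)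

/-- The plane map of a product. -/
noncomputable def planeMap (l : List (Equiv.Perm (Fin n))) : PlaneMap (ProductDart l) where
  rot :=
    { toFun := rot
      invFun
        | tail k => tail k
        | head k => head k
        | inc i k hk => out i k hk
        | out i k hk => inc i ((l.get i).symm k) fun h => hk (by
            rwa [(l.get i).apply_symm_apply, Equiv.eq_symm_apply] at h)
      left_inv d := by cases d <;> simp [rot]
      right_inv d := by cases d <;> simp [rot] }
  opp := opp
  opp_opp d := opp_eq_iff.2 (arrow_opp d).symm

@[simp] theorem coe_rot_planeMap : ⇑(planeMap l).rot = rot := rfl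

@[simp] theorem opp_planeMap : (planeMap l).opp = opp := rfl

theorem Before.nextLeaf {p : ℕ} (hp : p ≤ l.length) {d : ProductDart l} {k : Fin n}
    (h : Before d p k) : (planeMap l).NextLeaf d (head ((l.drop p).reverse.prod k)) := by
  induction hp using Nat.decreasingInduction generalizing d k with
  | of_succ p hp ih =>
    rw [List.drop_eq_getElem_cons hp, List.reverse_cons, List.prod_append, List.prod_singleton,
      Equiv.Perm.mul_apply]
    by_cases hk : l.get ⟨p, hp⟩ k = k
    · have := ih (h.succ (p := ⟨p, hp⟩) hk)
      rwa [← hk] at this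
    · have hopp : (planeMap l).opp d = inc ⟨p, hp⟩ k hk := (h.arrow (after_inc _ k hk)).opp_eq
      refine .go _ _ ?_ ?_ <;> rw [hopp]
      · exact nofun
      · exact ih (before_out _ _ _)
  | self =>
    rw [List.drop_length]
    have hopp : (planeMap l).opp d = head k := (h.arrow (after_head k)).opp_eq
    exact hopp ▸ PlaneMap.NextLeaf.arrive d (by rw [hopp]; rfl)

theorem After.nextLeaf {p : ℕ} (hp : p ≤ l.length) {d : ProductDart l} {k : Fin n}
    (h : After d p k) : (planeMap l).NextLeaf d (tail k) := by
  induction p generalizing d with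
  | zero =>
    have hopp : (planeMap l).opp d = tail k := ((before_tail k).arrow h).opp_eq'
    exact hopp ▸ PlaneMap.NextLeaf.arrive d (by rw [hopp]; rfl)
  | succ p ih =>
    by_cases hk : l.get ⟨p, hp⟩ k = k
    · exact ih (by omega) (h.pred (p := ⟨p, hp⟩) hk)
    · have hopp : (planeMap l).opp d = out ⟨p, hp⟩ k hk := ((before_out _ k hk).arrow h).opp_eq'
      refine .go _ _ ?_ ?_ <;> rw [hopp]
      · exact nofun
      · exact ih (by omega) (after_inc _ _ _)

theorem nextLeaf_tail (k : Fin n) : (planeMap l).NextLeaf (tail k) (head (l.reverse.prod k)) :=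
  (before_tail k).nextLeaf (Nat.zero_le _)

theorem nextLeaf_head (k : Fin n) : (planeMap l).NextLeaf (head k) (tail k) :=
  (after_head k).nextLeaf le_rfl

theorem nextLeaf_inc (i : Fin l.length) (k : Fin n) (hk) :
    (planeMap l).NextLeaf (inc i k hk) (tail k) :=
  (after_inc i k hk).nextLeaf i.2.le

/-- The half-edges: those at the leaves, and those at the vertices of the factors. -/
def equivSum (l : List (Equiv.Perm (Fin n))) :
    ProductDart l ≃ (Fin n ⊕ Fin n) ⊕ Σ i : Fin l.length, {k // l.get i k ≠ k} × Bool where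
  toFun
    | tail k => .inl (.inl k)
    | head k => .inl (.inr k)
    | inc i k hk => .inr ⟨i, ⟨k, hk⟩, true⟩
    | out i k hk => .inr ⟨i, ⟨k, hk⟩, false⟩
  invFun
    | .inl (.inl k) => tail k
    | .inl (.inr k) => head k
    | .inr ⟨i, k, true⟩ => inc i k.1 k.2
    | .inr ⟨i, k, false⟩ => out i k.1 k.2
  left_inv d := by cases d <;> rfl
  right_inv d := by rcases d with (k | k) | ⟨i, k, _ | _⟩ <;> rfl

instance fintype : Fintype (ProductDart l) := Fintype.ofEquiv _ (equivSum l).symm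

end ProductDart

theorem val_finRotate {n : ℕ} (k : Fin n) : (finRotate n k : ℕ) = (k + 1) % n := by
  cases n with
  | zero => exact k.elim0
  | succ n => simp [Fin.val_add]

namespace ProductDart

variable {n : ℕ} {l : List (Equiv.Perm (Fin n))}

theorem isConnectedFrom_head_zero [NeZero n] (hprod : l.reverse.prod = finRotate n) :
    (planeMap l).IsConnectedFrom (head 0) := by
  intro S h0 hrot hopp
  have htail_iff : ∀ k : Fin n, head k ∈ S ↔ tail k ∈ S := fun k =>
    (nextLeaf_head k).mem_iff hrot hopp
  have hhead_iff : ∀ k : Fin n, head (finRotate n k) ∈ S ↔ head k ∈ S := fun k => by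
    rw [htail_iff k, ← hprod]
    exact ((nextLeaf_tail k).mem_iff hrot hopp).symm
  have hhead : ∀ m (hm : m < n), head ⟨m, hm⟩ ∈ S := by
    intro m hm
    induction m with
    | zero => exact h0
    | succ m ih =>
      have := (hhead_iff ⟨m, by omega⟩).2 (ih _)
      rwa [show finRotate n ⟨m, by omega⟩ = ⟨m + 1, hm⟩ from
        Fin.ext (by rw [val_finRotate, Nat.mod_eq_of_lt hm])] at this
  have htail : ∀ k : Fin n, tail k ∈ S := fun k => (htail_iff k).1 (hhead k k.2)
  have hinc : ∀ i k hk, inc i k hk ∈ S := fun i k hk =>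
    ((nextLeaf_inc i k hk).mem_iff hrot hopp).2 (htail k)
  rintro (k | k | ⟨i, k, hk⟩ | ⟨i, k, hk⟩)
  exacts [htail k, hhead k k.2, hinc i k hk,
    (PlaneMap.mem_iff_of_vertex_eq hrot ((planeMap l).vertex_rot _)).1 (hinc i k hk)]

/-! ### Counting the vertices and half-edges of a product -/

/-- The vertex of a half-edge: a leaf `t_k`, a leaf `h_k`, or the vertex of a factor. -/
def vtx : ProductDart l → (Fin n ⊕ Fin n) ⊕ Fin l.length
  | tail k => .inl (.inl k)
  | head k => .inl (.inr k)
  | inc i _ _ => .inr i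
  | out i _ _ => .inr i

theorem vtx_iterate_rot (m : ℕ) (d : ProductDart l) : (rot^[m] d).vtx = d.vtx := by
  induction m with
  | zero => rfl
  | succ m ih =>
    rw [Function.iterate_succ_apply', ← ih]
    cases rot^[m] d <;> rfl

theorem sameCycle_inc (hl : ∀ σ ∈ l, σ.IsCycle) {i : Fin l.length} {k k' : Fin n}
    (hk : l.get i k ≠ k) (hk' : l.get i k' ≠ k') :
    (planeMap l).rot.SameCycle (inc i k hk) (inc i k' hk') := by
  obtain ⟨m, rfl⟩ := (hl _ (l.get_mem i)).exists_pow_eq hk hk'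
  induction m with
  | zero => exact .refl _ _
  | succ m ih =>
    have hm : l.get i ((l.get i ^ m) k) ≠ (l.get i ^ m) k := fun h => hk' <| by
      rw [pow_succ', Equiv.Perm.mul_apply, h, h]
    have hrot : inc i ((l.get i ^ (m + 1)) k) hk' =
        (planeMap l).rot ((planeMap l).rot (inc i _ hm)) := by
      simp only [coe_rot_planeMap, rot, pow_succ', Equiv.Perm.mul_apply]
    rw [hrot, Equiv.Perm.sameCycle_apply_right, Equiv.Perm.sameCycle_apply_right]
    exact ih hm

theorem vertex_eq_vertex_iff (hl : ∀ σ ∈ l, σ.IsCycle) {d d' : ProductDart l} :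
    (planeMap l).vertex d = (planeMap l).vertex d' ↔ d.vtx = d'.vtx := by
  constructor
  · rw [PlaneMap.vertex_eq_vertex_iff_exists_iterate]
    rintro ⟨m, rfl⟩
    exact (vtx_iterate_rot m d).symm
  · have hout : ∀ i k hk, (planeMap l).vertex (out i k hk) = (planeMap l).vertex (inc i k hk) :=
      fun i k hk => ((planeMap l).vertex_rot (out i k hk)).symm
    intro h
    cases d <;> cases d' <;> cases h
    · rfl
    · rfl
    all_goals
      simp only [hout, PlaneMap.vertex_eq_vertex_iff]
      exact sameCycle_inc hl _ _

theorem card_vertex (hl : ∀ σ ∈ l, σ.IsCycle) :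
    Nat.card (planeMap l).Vertex = 2 * n + l.length := by
  let v : (planeMap l).Vertex → (Fin n ⊕ Fin n) ⊕ Fin l.length :=
    Quotient.lift vtx fun d d' h => (vertex_eq_vertex_iff hl).1 (Quotient.sound h)
  have hv : Function.Bijective v := by
    refine ⟨fun w w' => Quotient.inductionOn₂ w w' fun d d' h => (vertex_eq_vertex_iff hl).2 h, ?_⟩
    rintro ((k | k) | i)
    · exact ⟨(planeMap l).vertex (tail k), rfl⟩
    · exact ⟨(planeMap l).vertex (head k), rfl⟩
    · obtain ⟨k, hk, -⟩ := hl _ (l.get_mem i)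
      exact ⟨(planeMap l).vertex (inc i k hk), rfl⟩
  rw [Nat.card_congr (.ofBijective v hv), Nat.card_sum, Nat.card_sum, Nat.card_fin, Nat.card_fin]
  omega

theorem sum_vtx (v : (Fin n ⊕ Fin n) ⊕ Fin l.length → ℕ) :
    ∑ d : ProductDart l, v d.vtx = ∑ k, (v (.inl (.inl k)) + v (.inl (.inr k))) +
      ∑ i, 2 * (l.get i).support.card * v (.inr i) := by
  have hmoved : ∀ i : Fin l.length,
      Fintype.card {k // l.get i k ≠ k} = (l.get i).support.card := fun i =>
    Fintype.card_of_subtype _ fun _ => Equiv.Perm.mem_support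
  rw [← (equivSum l).symm.sum_comp, Fintype.sum_sum_type, Fintype.sum_sum_type, Fintype.sum_sigma,
    Finset.sum_add_distrib]
  refine congrArg (_ + _ + ·) (Finset.sum_congr rfl fun i _ => ?_)
  rw [Finset.sum_congr rfl (g := fun _ => v (.inr i)), Finset.sum_const, Finset.card_univ,
    Fintype.card_prod, Fintype.card_bool, hmoved, smul_eq_mul, mul_comm _ 2]
  rintro ⟨k, _ | _⟩ - <;> rfl

theorem card_eq : Nat.card (ProductDart l) = 2 * n + 2 * ∑ i, (l.get i).support.card := by
  rw [Nat.card_eq_fintype_card, Fintype.card_eq_sum_ones, sum_vtx fun _ => 1, Finset.mul_sum]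
  simp [mul_comm]

/-- The degree of a vertex. -/
def deg (l : List (Equiv.Perm (Fin n))) : (Fin n ⊕ Fin n) ⊕ Fin l.length → ℕ
  | .inl _ => 1
  | .inr i => 2 * (l.get i).support.card

theorem minimalPeriod_rot (hl : ∀ σ ∈ l, σ.IsCycle) (d : ProductDart l) :
    Function.minimalPeriod rot d = deg l d.vtx := by
  have hfactor : ∀ i, d.vtx = .inr i → Function.minimalPeriod rot d = deg l d.vtx := by
    classical
    intro i hi
    rw [← coe_rot_planeMap, PlaneMap.minimalPeriod_rot, hi, deg, Set.ncard_eq_toFinset_card',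
      Set.toFinset_ofPred, Finset.card_filter]
    simp only [vertex_eq_vertex_iff hl, hi]
    rw [sum_vtx fun w => if .inr i = w then 1 else 0]
    simp
  cases d with
  | tail => exact Function.minimalPeriod_eq_one_iff_isFixedPt.2 rfl
  | head => exact Function.minimalPeriod_eq_one_iff_isFixedPt.2 rfl
  | inc i => exact hfactor i rfl
  | out i => exact hfactor i rfl

end ProductDart

theorem sum_mul_ite_eq_mul_countP {X : Type*} (l : List X) (c : X → ℕ) (k : ℕ) :
    (∑ i : Fin l.length, c (l.get i) * if c (l.get i) = k then 1 else 0) =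
      k * l.countP fun x => c x = k := by
  refine (Fin.sum_univ_fun_getElem l fun x => c x * if c x = k then 1 else 0).trans ?_
  induction l with
  | nil => rfl
  | cons x l ih =>
    rw [List.map_cons, List.sum_cons, ih, List.countP_cons]
    by_cases h : c x = k
    · simp [h, mul_add, add_comm]
    · simp [h]

theorem ProductDart.card_minimalPeriod {n : ℕ} {l : List (Equiv.Perm (Fin n))}
    (hl : ∀ σ ∈ l, σ.IsCycle) (k : ℕ) :
    Nat.card {d : ProductDart l // Function.minimalPeriod rot d = k} =
      (if k = 1 then 2 * n else 0) + k * l.countP fun σ => 2 * σ.support.card = k := by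
  classical
  rw [Nat.card_eq_fintype_card, Fintype.card_subtype, Finset.card_filter]
  simp only [minimalPeriod_rot hl]
  rw [sum_vtx fun w => if deg l w = k then 1 else 0, ← sum_mul_ite_eq_mul_countP]
  congr 1
  by_cases hk : k = 1
  · simp [deg, hk, mul_comm]
  · simp [deg, hk, Ne.symm hk]

namespace PlantedTree

open PlaneMap

/-! ### The tree of a product -/

variable {n : ℕ} [NeZero n] {l : List (Equiv.Perm (Fin n))} {T T' : PlantedTree}

theorem isTreeOfProduct_iff : T.IsTreeOfProduct l ↔ ∃ g : T.Dart ≃ ProductDart l,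
    IsHom T.planeMap (ProductDart.planeMap l) g ∧ g T.rootDart = .head 0 := by
  constructor
  · rintro ⟨φ, hrot, hopp, hroot⟩
    have hφ : IsHom (ProductDart.planeMap l) T.planeMap φ :=
      ⟨hrot, fun d => ((hopp d d.opp).1 d.arrow_opp).symm⟩
    exact ⟨φ.symm, hφ.symm, φ.symm_apply_eq.2 hroot.symm⟩
  · rintro ⟨g, hg, hroot⟩
    refine ⟨g.symm, hg.symm.map_rot, fun d d' => ?_, g.symm_apply_eq.2 hroot.symm⟩
    have hopp : g.symm d.opp = opp (g.symm d) := hg.symm.map_opp d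
    rw [← ProductDart.opp_eq_iff, ← hopp, g.symm.apply_eq_iff_eq]

theorem vertexCount_zero (T : PlantedTree) : T.vertexCount 0 = 0 := by
  induction T with
  | node c f ih => simp [vertexCount_node, ih]

namespace IsTreeOfProduct

theorem unique (h : T.IsTreeOfProduct l) (h' : T'.IsTreeOfProduct l) : T = T' := by
  obtain ⟨g, hg, hroot⟩ := isTreeOfProduct_iff.1 h
  obtain ⟨g', hg', hroot'⟩ := isTreeOfProduct_iff.1 h'
  exact eq_of_isHom g g' hg hg' (hroot.trans hroot'.symm)

theorem mul_vertexCount (h : T.IsTreeOfProduct l) (hl : ∀ σ ∈ l, σ.IsCycle) (k : ℕ) :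
    (k * T.vertexCount k + if k = 1 then 1 else 0) =
      (if k = 1 then 2 * n else 0) + k * l.countP fun σ => 2 * σ.support.card = k := by
  obtain ⟨g, hg, -⟩ := isTreeOfProduct_iff.1 h
  rw [← card_minimalPeriod, ← ProductDart.card_minimalPeriod hl]
  exact Nat.card_congr (g.subtypeEquiv fun d => by
    rw [← ProductDart.coe_rot_planeMap, hg.minimalPeriod_eq g.injective, coe_rot_planeMap])

theorem vertexCount_one (h : T.IsTreeOfProduct l) (hl : ∀ σ ∈ l, σ.IsCycle) :
    T.vertexCount 1 + 1 = 2 * n := by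
  have hodd : (l.countP fun σ => 2 * σ.support.card = 1) = 0 := by
    simp only [List.countP_eq_zero, decide_eq_true_eq]
    omega
  simpa only [one_mul, if_true, hodd, add_zero] using h.mul_vertexCount hl 1

theorem vertexCount_eq_countP (h : T.IsTreeOfProduct l) (hl : ∀ σ ∈ l, σ.IsCycle) {k : ℕ}
    (hk : k ≠ 0) (hk' : k ≠ 1) :
    T.vertexCount k = l.countP fun σ => 2 * σ.support.card = k := by
  have := h.mul_vertexCount hl k
  rw [if_neg hk', if_neg hk', add_zero, zero_add] at this
  exact Nat.eq_of_mul_eq_mul_left hk.bot_lt this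

theorem vertexCount_two_mul (h : T.IsTreeOfProduct l) (hl : ∀ σ ∈ l, σ.IsCycle) {j : ℕ}
    (hj : j ≠ 0) : T.vertexCount (2 * j) = l.countP fun σ => σ.support.card = j := by
  rw [h.vertexCount_eq_countP hl (by omega) (by omega)]
  simp only [Nat.mul_right_inj two_ne_zero]

variable {α : ℕ →₀ ℕ}

theorem hasType (h : T.IsTreeOfProduct l) (hl : IsMinimalFactorization n α l) :
    T.HasType n α where
  leaves := h.vertexCount_one hl.isCycle
  internal j hj := by rw [h.vertexCount_two_mul hl.isCycle (by omega), hl.type_eq j hj]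
  only d hd := by
    refine or_iff_not_imp_left.2 fun hd1 => ?_
    have hd0 : d ≠ 0 := by rintro rfl; exact hd T.vertexCount_zero
    rw [h.vertexCount_eq_countP hl.isCycle hd0 hd1, ← Nat.pos_iff_ne_zero,
      List.countP_pos_iff] at hd
    obtain ⟨σ, hσ, hσd⟩ := hd
    exact ⟨_, (hl.isCycle σ hσ).two_le_card_support, (of_decide_eq_true hσd).symm⟩

theorem isMinimalFactorization (h : T.IsTreeOfProduct l) (hT : T.HasType n α)
    (hl : ∀ σ ∈ l, σ.IsCycle) (hprod : l.reverse.prod = finRotate n) :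
    IsMinimalFactorization n α l where
  isCycle := hl
  prod_eq := hprod
  type_eq j hj := by rw [← h.vertexCount_two_mul hl (by omega), hT.internal j hj]
  minimal := hT.typeRank_add_one

end IsTreeOfProduct

end PlantedTree

/-! ### The tree of a minimal factorization -/

namespace IsMinimalFactorization

variable {n : ℕ} {α : ℕ →₀ ℕ} {l : List (Equiv.Perm (Fin n))}

theorem sum_card_support_sub_one (h : IsMinimalFactorization n α l) :
    (l.map fun σ => σ.support.card - 1).sum = typeRank α := by
  have hcount : ∀ j, 2 ≤ j → (l.map fun σ => σ.support.card).count j = α j := fun j hj => by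
    rw [← h.type_eq j hj, List.count, List.countP_map]
    rfl
  have htwo : ∀ j ∈ l.map fun σ => σ.support.card, 2 ≤ j :=
    List.forall_mem_map.2 fun σ hσ => (h.isCycle σ hσ).two_le_card_support
  rw [show (fun σ : Equiv.Perm (Fin n) => σ.support.card - 1) =
    (fun j => j - 1) ∘ fun σ => σ.support.card from rfl, ← List.map_map,
    Finset.sum_list_map_count, typeRank, Finsupp.sum]
  refine (Finset.sum_congr rfl fun j hj => ?_).trans
    (Finset.sum_subset (fun j hj => ?_) fun j _ hj => ?_) <;> rw [List.mem_toFinset] at hj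
  · rw [hcount j (htwo j hj), smul_eq_mul, mul_comm]
  · rw [Finsupp.mem_support_iff, ← hcount j (htwo j hj)]
    exact (List.count_pos_iff.2 hj).ne'
  · rcases lt_or_ge j 2 with hj2 | hj2
    · rw [Nat.sub_eq_zero_of_le (by omega), zero_mul]
    · rw [← hcount j hj2, List.count_eq_zero_of_not_mem hj, mul_zero]

theorem sum_card_support (h : IsMinimalFactorization n α l) :
    ∑ i : Fin l.length, (l.get i).support.card + 1 = n + l.length := by
  have hsub : (l.map fun σ => σ.support.card - 1 + 1).sum = typeRank α + l.length := by
    rw [List.sum_map_add, h.sum_card_support_sub_one]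
    simp
  have hcard : (l.map fun σ => σ.support.card - 1 + 1) = l.map fun σ => σ.support.card :=
    List.map_congr_left fun σ hσ =>
      Nat.sub_add_cancel (one_le_two.trans (h.isCycle σ hσ).two_le_card_support)
  have hsum := Fin.sum_univ_fun_getElem l fun σ => σ.support.card
  simp only [List.get_eq_getElem]
  rw [hsum, ← hcard, hsub, add_right_comm, h.minimal]

theorem two_mul_card_vertex (h : IsMinimalFactorization n α l) :
    2 * Nat.card (ProductDart.planeMap l).Vertex = Nat.card (ProductDart l) + 2 := by
  have := h.sum_card_support
  rw [ProductDart.card_vertex h.isCycle, ProductDart.card_eq]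
  omega

theorem exists_isTreeOfProduct [NeZero n] (h : IsMinimalFactorization n α l) :
    ∃ T : PlantedTree, T.IsTreeOfProduct l :=
  (PlantedTree.exists_equiv_isHom (ProductDart.isConnectedFrom_head_zero h.prod_eq) rfl
    h.two_mul_card_vertex).imp fun _ => PlantedTree.isTreeOfProduct_iff.2

/-- Two common moved points of adjacent commuting factors would give a double edge. -/
theorem disjoint_of_commute [NeZero n] (h : IsMinimalFactorization n α l) {i j : Fin l.length}
    (hij : (j : ℕ) = i + 1) (hc : Commute (l.get i) (l.get j)) :
    (l.get i).Disjoint (l.get j) := by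
  obtain ⟨up, lev, hl⟩ :=
    (ProductDart.isConnectedFrom_head_zero h.prod_eq).exists_isLeveling h.two_mul_card_vertex
  refine fun k => or_iff_not_imp_left.2 fun hi => by_contra fun hj => ?_
  have hi' : l.get i (l.get i k) ≠ l.get i k := fun h => hi ((l.get i).injective h)
  have hj' : l.get j (l.get i k) ≠ l.get i k := by
    rw [← Equiv.Perm.mul_apply, ← hc.eq, Equiv.Perm.mul_apply]
    exact fun h => hj ((l.get i).injective h)
  have hopp : ∀ k (hi : l.get i k ≠ k) (hj : l.get j k ≠ k),
      (ProductDart.out i k hi).opp = .inc j k hj := fun k hi hj =>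
    ((ProductDart.before_out i k hi).arrow (hij ▸ ProductDart.after_inc j k hj)).opp_eq
  have heq : ProductDart.out i k hi = .out i (l.get i k) hi' := by
    apply hl.eq_of_vertex_eq <;> rw [ProductDart.vertex_eq_vertex_iff h.isCycle]
    · rfl
    · rw [ProductDart.opp_planeMap, hopp k hi hj, hopp _ hi' hj']
      rfl
  exact hi (ProductDart.out.inj heq).2.symm

end IsMinimalFactorization

/-! ### Reordering the factors -/

namespace ProductDart

variable {n : ℕ} {l l' : List (Equiv.Perm (Fin n))} {e : Fin l'.length ≃ Fin l.length}

/-- The map of half-edges induced by a bijection between the factors of two products. -/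
def reorder (e : Fin l'.length ≃ Fin l.length) (he : ∀ i, l'.get i = l.get (e i)) :
    ProductDart l ≃ ProductDart l' where
  toFun
    | tail k => tail k
    | head k => head k
    | inc i k hk => inc (e.symm i) k (by rwa [he, e.apply_symm_apply])
    | out i k hk => out (e.symm i) k (by rwa [he, e.apply_symm_apply])
  invFun
    | tail k => tail k
    | head k => head k
    | inc i k hk => inc (e i) k (by rwa [← he])
    | out i k hk => out (e i) k (by rwa [← he])
  left_inv d := by cases d <;> simp
  right_inv d := by cases d <;> simp

theorem reorder_rot (he : ∀ i, l'.get i = l.get (e i)) (d : ProductDart l) :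
    reorder e he d.rot = (reorder e he d).rot := by
  cases d with
  | inc i k hk =>
    simp only [reorder, rot, Equiv.coe_fn_mk, out.injEq, true_and]
    rw [he, e.apply_symm_apply]
  | _ => rfl

theorem Arrow.reorder (he : ∀ i, l'.get i = l.get (e i))
    (hmono : ∀ i j, i < j → ∀ k, l'.get i k ≠ k → l'.get j k ≠ k → e i < e j)
    {d d' : ProductDart l} (h : Arrow d d') :
    Arrow (ProductDart.reorder e he d) (ProductDart.reorder e he d') := by
  have hmoved : ∀ {i k}, l.get i k ≠ k → l'.get (e.symm i) k ≠ k := fun h => by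
    rwa [he, e.apply_symm_apply]
  have hfix : ∀ {r k}, (l'.get r k ≠ k → l.get (e r) k = k) → l'.get r k = k := fun h =>
    by_contra fun hr => hr (by rw [he, h hr])
  have hlt : ∀ {i r k}, l.get i k ≠ k → l'.get r k ≠ k → e.symm i < r → i < e r := fun hi hr h =>
    (e.apply_symm_apply _).symm.trans_lt (hmono _ _ h _ (hmoved hi) hr)
  have hgt : ∀ {i r k}, l.get i k ≠ k → l'.get r k ≠ k → r < e.symm i → e r < i := fun hi hr h =>
    (hmono _ _ h _ hr (hmoved hi)).trans_eq (e.apply_symm_apply _)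
  cases h with
  | tail_head k h => exact .tail_head k fun r => hfix fun _ => h _
  | tail_inc j k hj h => exact .tail_inc _ k _ fun r hr => hfix fun hk => h _ (hgt hj hk hr)
  | out_inc i j k hi hj hij h =>
    have hij' : e.symm i < e.symm j := (lt_trichotomy (e.symm i) (e.symm j)).resolve_right <| by
      rintro (heq | hji)
      · exact hij.ne (e.symm.injective heq)
      · exact hij.not_gt (e.apply_symm_apply i ▸ hlt hj (hmoved hi) hji)
    exact .out_inc _ _ k _ _ hij' fun r hr hr' => hfix fun hk => h _ (hlt hi hk hr) (hgt hj hk hr')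
  | out_head i k hi h => exact .out_head _ k _ fun r hr => hfix fun hk => h _ (hlt hi hk hr)

theorem isHom_reorder (he : ∀ i, l'.get i = l.get (e i))
    (hmono : ∀ i j, i < j → ∀ k, l'.get i k ≠ k → l'.get j k ≠ k → e i < e j) :
    PlaneMap.IsHom (planeMap l) (planeMap l') (reorder e he) where
  map_rot := reorder_rot he
  map_opp d := (opp_eq_iff.2 (d.arrow_opp.imp (·.reorder he hmono) (·.reorder he hmono))).symm

end ProductDart

theorem PlantedTree.IsTreeOfProduct.reorder {n : ℕ} [NeZero n] {l l' : List (Equiv.Perm (Fin n))}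
    {T : PlantedTree} (h : T.IsTreeOfProduct l) {e : Fin l'.length ≃ Fin l.length}
    (he : ∀ i, l'.get i = l.get (e i))
    (hmono : ∀ i j, i < j → ∀ k, l'.get i k ≠ k → l'.get j k ≠ k → e i < e j) :
    T.IsTreeOfProduct l' := by
  obtain ⟨g, hg, hroot⟩ := isTreeOfProduct_iff.1 h
  have hφ := ProductDart.isHom_reorder he hmono
  exact isTreeOfProduct_iff.2 ⟨g.trans (ProductDart.reorder e he), hφ.comp hg,
    congrArg (ProductDart.reorder e he) hroot⟩

section SwapNeighbours

variable {X : Type*} (a b : List X) (x y : X)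

theorem getElem?_append_cons_cons (m : ℕ) :
    (a ++ y :: x :: b)[m]? = (a ++ x :: y :: b)[Equiv.swap a.length (a.length + 1) m]? := by
  rcases lt_or_ge m a.length with hm | hm
  · rw [Equiv.swap_apply_of_ne_of_ne (by omega) (by omega), List.getElem?_append_left hm,
      List.getElem?_append_left hm]
  · obtain ⟨r, rfl⟩ := Nat.exists_eq_add_of_le hm
    match r with
    | 0 => simp
    | 1 => simp
    | r + 2 =>
      rw [Equiv.swap_apply_of_ne_of_ne (by omega) (by omega)]
      simp [List.getElem?_append_right]

theorem exists_equiv_get_append_cons_cons :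
    ∃ e : Fin (a ++ y :: x :: b).length ≃ Fin (a ++ x :: y :: b).length,
      (∀ i, (a ++ y :: x :: b).get i = (a ++ x :: y :: b).get (e i)) ∧
      ∀ i j : Fin _, i < j → ¬((i : ℕ) = a.length ∧ (j : ℕ) = a.length + 1) → e i < e j := by
  let e : Fin (a ++ y :: x :: b).length ≃ Fin (a ++ x :: y :: b).length :=
    (finCongr (by simp)).trans (.swap ⟨a.length, by simp⟩ ⟨a.length + 1, by simp⟩)
  have hval : ∀ i, (e i : ℕ) = Equiv.swap a.length (a.length + 1) i := fun i =>
    (Fin.val_injective.swap_apply _ _ _).symm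
  refine ⟨e, fun i => Option.some_injective _ ?_, fun i j hij hne => ?_⟩
  · rw [List.get_eq_getElem, List.get_eq_getElem, ← List.getElem?_eq_getElem,
      ← List.getElem?_eq_getElem, hval, getElem?_append_cons_cons]
  · rw [Fin.lt_def] at hij ⊢
    rw [hval, hval, Equiv.swap_apply_def, Equiv.swap_apply_def]
    split_ifs <;> omega

end SwapNeighbours

namespace CommutationMove

variable {n : ℕ} {α : ℕ →₀ ℕ} {l l' : List (Equiv.Perm (Fin n))}

theorem symm (h : CommutationMove l l') : CommutationMove l' l := by
  obtain ⟨a, b, σ, τ, hc, hl, hl'⟩ := h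
  exact ⟨a, b, τ, σ, hc.symm, hl', hl⟩

theorem prod_reverse_eq (h : CommutationMove l l') : l.reverse.prod = l'.reverse.prod := by
  obtain ⟨a, b, σ, τ, hc, rfl, rfl⟩ := h
  simp only [List.reverse_append, List.reverse_cons, List.prod_append, List.prod_singleton]
  rw [mul_assoc b.reverse.prod, hc.symm.eq, ← mul_assoc b.reverse.prod]

theorem perm (h : CommutationMove l l') : l.Perm l' := by
  obtain ⟨a, b, σ, τ, -, rfl, rfl⟩ := h
  exact (List.Perm.swap _ _ _).append_left a

theorem isMinimalFactorization (h : CommutationMove l l') (hl : IsMinimalFactorization n α l) :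
    IsMinimalFactorization n α l' where
  isCycle σ hσ := hl.isCycle σ (h.perm.mem_iff.2 hσ)
  prod_eq := by rw [← h.prod_reverse_eq, hl.prod_eq]
  type_eq j hj := by rw [← h.perm.countP_eq, hl.type_eq j hj]
  minimal := hl.minimal

theorem isTreeOfProduct [NeZero n] {T : PlantedTree} (h : CommutationMove l l')
    (hl : IsMinimalFactorization n α l) (hT : T.IsTreeOfProduct l) : T.IsTreeOfProduct l' := by
  have hl' := h.isMinimalFactorization hl
  obtain ⟨a, b, σ, τ, hc, rfl, rfl⟩ := h
  obtain ⟨e, he, hlt⟩ := exists_equiv_get_append_cons_cons a b σ τ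
  refine hT.reorder he fun i j hij k hi hj => hlt i j hij fun ⟨hia, hja⟩ => ?_
  have hcomm : Commute ((a ++ τ :: σ :: b).get i) ((a ++ τ :: σ :: b).get j) := by
    simpa [hia, hja] using hc.symm
  exact (hl'.disjoint_of_commute (hja.trans (congrArg (· + 1) hia.symm)) hcomm k).elim hi hj

theorem isMinimalFactorization_iff_of_eqvGen (h : Relation.EqvGen CommutationMove l l') :
    IsMinimalFactorization n α l ↔ IsMinimalFactorization n α l' := by
  induction h with
  | rel l l' h => exact ⟨h.isMinimalFactorization, h.symm.isMinimalFactorization⟩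
  | refl => exact .rfl
  | symm l l' _ ih => exact ih.symm
  | trans l l' l'' _ _ ih ih' => exact ih.trans ih'

theorem isTreeOfProduct_iff_of_eqvGen [NeZero n] {T : PlantedTree}
    (h : Relation.EqvGen CommutationMove l l') (hl : IsMinimalFactorization n α l) :
    T.IsTreeOfProduct l ↔ T.IsTreeOfProduct l' := by
  induction h with
  | rel l l' h =>
    exact ⟨h.isTreeOfProduct hl, h.symm.isTreeOfProduct (h.isMinimalFactorization hl)⟩
  | refl => exact .rfl
  | symm l l' h ih => exact (ih ((isMinimalFactorization_iff_of_eqvGen h).2 hl)).symm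
  | trans l l' l'' h _ ih ih' =>
    exact (ih hl).trans (ih' ((isMinimalFactorization_iff_of_eqvGen h).1 hl))

theorem cons (σ : Equiv.Perm (Fin n)) (h : CommutationMove l l') :
    CommutationMove (σ :: l) (σ :: l') := by
  obtain ⟨a, b, τ, τ', hc, rfl, rfl⟩ := h
  exact ⟨σ :: a, b, τ, τ', hc, rfl, rfl⟩

theorem eqvGen_cons (σ : Equiv.Perm (Fin n)) (h : Relation.EqvGen CommutationMove l l') :
    Relation.EqvGen CommutationMove (σ :: l) (σ :: l') := by
  induction h with
  | rel _ _ h => exact .rel _ _ (h.cons σ)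
  | refl => exact .refl _
  | symm _ _ _ ih => exact .symm _ _ ih
  | trans _ _ _ _ _ ih ih' => exact .trans _ _ _ ih ih'

theorem eqvGen_middle {σ : Equiv.Perm (Fin n)} (h : ∀ τ ∈ l, Commute τ σ) :
    Relation.EqvGen CommutationMove (l ++ σ :: l') (σ :: (l ++ l')) := by
  induction l with
  | nil => exact .refl _
  | cons τ l ih =>
    refine .trans _ _ _ (eqvGen_cons τ (ih fun τ' hτ' => h τ' (List.mem_cons_of_mem _ hτ'))) ?_
    exact .rel _ _ ⟨[], l ++ l', τ, σ, h τ List.mem_cons_self, rfl, rfl⟩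

end CommutationMove

namespace PlantedTree

open PlaneMap

/-! ### The labels of the leaves -/

theorem mem_star_iff {T : PlantedTree} {x y : T.Dart} :
    y ∈ star x ↔ T.planeMap.vertex x = T.planeMap.vertex y :=
  T.planeMap.vertex_eq_vertex_iff_exists_iterate.symm

/-- The half-edges at the leaves in counterclockwise order, starting with the root. The value is
junk (the root again) if there are fewer than `i + 1` leaves. -/
def leafDart (T : PlantedTree) (i : ℕ) : T.Dart := T.leafDarts.getD i T.rootDart

theorem length_leafDarts (T : PlantedTree) : T.leafDarts.length = T.vertexCount 1 + 1 := by
  simp [leafDarts, length_leaves]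

theorem nextLeaf_leafDart (T : PlantedTree) {i : ℕ} (hi : i < T.vertexCount 1 + 1) :
    T.planeMap.NextLeaf (T.leafDart i) (T.leafDart (i + 1)) := by
  have h := List.isChain_iff_getElem.1 T.isChain_leafDarts i (by simpa [length_leafDarts] using hi)
  rw [← length_leafDarts] at hi
  convert h using 1
  · simp [leafDart, hi]
  · rcases (Nat.succ_le_of_lt hi).lt_or_eq with h' | h'
    · simp [leafDart, h']
    · simp [leafDart, ← h']

theorem leafDart_vertexCount (T : PlantedTree) : T.leafDart (T.vertexCount 1 + 1) = T.rootDart := by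
  simp [leafDart, ← length_leafDarts]

theorem exists_leafDart {T : PlantedTree} {x : T.Dart} (hx : T.rot x = x) :
    ∃ i < T.vertexCount 1 + 1, x = T.leafDart i := by
  obtain ⟨i, hi, rfl⟩ := List.getElem_of_mem (mem_leafDarts hx)
  exact ⟨i, by rwa [← length_leafDarts], by simp [leafDart, hi]⟩

theorem liftVertex_eq_liftVertex {c : ℕ} {f : Fin c → PlantedTree} {i j : Fin c}
    {v : (f i).Vertex} {w : (f j).Vertex} (h : liftVertex (f := f) i v = liftVertex j w) :
    i = j ∧ v ≍ w := by
  cases h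
  exact ⟨rfl, .rfl⟩

theorem nodup_leaves (T : PlantedTree) : T.leaves.Nodup := by
  induction T with
  | node c f ih =>
    by_cases hc : c = 0
    · subst hc
      rw [leaves_node_zero]
      exact List.nodup_singleton _
    · rw [leaves_node hc, List.nodup_flatMap]
      refine ⟨fun i _ => (ih i).map fun v w h => eq_of_heq (liftVertex_eq_liftVertex h).2,
        (List.nodup_finRange _).imp fun {i j} hij v hv hv' => ?_⟩
      obtain ⟨x, -, rfl⟩ := List.mem_map.1 hv
      obtain ⟨y, -, hy⟩ := List.mem_map.1 hv'
      exact hij (liftVertex_eq_liftVertex hy).1.symm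

theorem leafDart_injOn {T : PlantedTree} {i j : ℕ} (hi : i < T.vertexCount 1 + 1)
    (hj : j < T.vertexCount 1 + 1) (h : T.leafDart i = T.leafDart j) : i = j := by
  have hnd : T.leafDarts.Nodup := by
    refine List.nodup_cons.2 ⟨by simp [rootDart], T.nodup_leaves.map fun v w h => ?_⟩
    cases h; rfl
  rw [← length_leafDarts] at hi hj
  exact (hnd.getElem_inj_iff (hi := hi) (hj := hj)).1 (by simpa [leafDart, hi, hj] using h)

/-- The half-edge at the leaf `h_k`. -/
def headDart (T : PlantedTree) {n : ℕ} (k : Fin n) : T.Dart := T.leafDart (2 * k)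

/-- The half-edge at the leaf `t_k`. -/
def tailDart (T : PlantedTree) {n : ℕ} (k : Fin n) : T.Dart := T.leafDart (2 * k + 1)

section Leaves

variable {n : ℕ} {T : PlantedTree} (hn : T.vertexCount 1 + 1 = 2 * n)
include hn

theorem nextLeaf_headDart (k : Fin n) : T.planeMap.NextLeaf (T.headDart k) (T.tailDart k) :=
  T.nextLeaf_leafDart (by omega)

theorem nextLeaf_tailDart (k : Fin n) :
    T.planeMap.NextLeaf (T.tailDart k) (T.headDart (finRotate n k)) := by
  have h := T.nextLeaf_leafDart (i := 2 * k + 1) (by omega)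
  suffices T.headDart (finRotate n k) = T.leafDart (2 * k + 1 + 1) by rw [this]; exact h
  rw [headDart, val_finRotate]
  rcases (Nat.succ_le_of_lt k.2).lt_or_eq with h' | h'
  · rw [Nat.mod_eq_of_lt h']; rfl
  · rw [← Nat.succ_eq_add_one, h', Nat.mod_self,
      show 2 * (k : ℕ) + 1 + 1 = T.vertexCount 1 + 1 by omega, leafDart_vertexCount]; rfl

theorem tailDart_injective : Function.Injective (T.tailDart (n := n)) := fun j k h => by
  have := leafDart_injOn (by omega) (by omega) h
  omega

theorem rot_tailDart (k : Fin n) : T.rot (T.tailDart k) = T.tailDart k :=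
  (nextLeaf_headDart hn k).rot_eq

theorem rot_headDart (k : Fin n) : T.rot (T.headDart k) = T.headDart k := by
  have := (nextLeaf_tailDart hn ((finRotate n).symm k)).rot_eq
  rwa [Equiv.apply_symm_apply] at this

theorem exists_headDart_or_tailDart {x : T.Dart} (hx : T.rot x = x) :
    ∃ k : Fin n, x = T.headDart k ∨ x = T.tailDart k := by
  obtain ⟨i, hi, rfl⟩ := exists_leafDart hx
  refine ⟨⟨i / 2, by omega⟩, ?_⟩
  rcases Nat.mod_two_eq_zero_or_one i with h | h
  · exact .inl (congrArg T.leafDart (show i = 2 * (i / 2) by omega))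
  · exact .inr (congrArg T.leafDart (show i = 2 * (i / 2) + 1 by omega))

end Leaves

/-! ### Labelled trees -/

/-- An alternating colouring `col` together with a potential `ht` of the vertices which increases
by one along each directed edge. Its existence shows that the directed tree has no cycles. -/
structure IsGraded {T : PlantedTree} (col : T.Dart → Bool) (ht : T.Dart → ℤ) : Prop
    extends IsAlternating col where
  ht_rot : ∀ x, ht (T.rot x) = ht x
  ht_opp : ∀ x, ht (opp x) = ht x + if col x then -1 else 1

namespace IsGraded

variable {T : PlantedTree} {col : T.Dart → Bool} {ht : T.Dart → ℤ} (hc : IsGraded col ht)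
include hc

theorem ht_eq {x y : T.Dart} (h : T.planeMap.vertex x = T.planeMap.vertex y) : ht x = ht y := by
  obtain ⟨r, rfl⟩ := T.planeMap.vertex_eq_vertex_iff_exists_iterate.1 h
  induction r with
  | zero => rfl
  | succ r ih =>
    rw [Function.iterate_succ_apply', coe_rot_planeMap, hc.ht_rot, ← coe_rot_planeMap]
    exact ih (T.planeMap.vertex_iterate_rot _ _).symm

theorem ht_opp_of_col {x : T.Dart} (hx : col x = true) : ht (opp x) = ht x - 1 := by
  rw [hc.ht_opp, if_pos hx]; rfl

theorem col_step {x : T.Dart} (h : T.rot (opp x) ≠ opp x) :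
    col (T.rot (opp x)) = col x := by
  rw [hc.col_rot _ h, hc.col_opp, Bool.not_not]

theorem ht_step {x : T.Dart} (hx : col x = true) :
    ht (T.rot (opp x)) = ht x - 1 := by
  rw [hc.ht_rot, hc.ht_opp_of_col hx]

theorem col_nextLeaf {e z : T.Dart} (h : T.planeMap.NextLeaf e z) : col z = !col e := by
  induction h with
  | arrive e _ => exact hc.col_opp e
  | go e z he _ ih => rw [ih]; exact congrArg _ (hc.col_step he)

theorem ht_nextLeaf {e z : T.Dart} (h : T.planeMap.NextLeaf e z) (he : col e = true) :
    ht z < ht e := by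
  induction h with
  | arrive e _ =>
    have := hc.ht_opp_of_col he
    rw [opp_planeMap]
    omega
  | go e z he' _ ih =>
    have h1 := ih ((hc.col_step he').trans he)
    have h2 := hc.ht_step he
    rw [coe_rot_planeMap, opp_planeMap] at h1
    omega

theorem eq_of_nextLeaf {e e' z : T.Dart} (h : T.planeMap.NextLeaf e z)
    (h' : T.planeMap.NextLeaf e' z) (he : col e = true) (he' : col e' = true)
    (hht : ht e = ht e') : e = e' := by
  have hlt : ∀ {e z : T.Dart}, T.planeMap.NextLeaf (T.rot (opp e)) z → col e = true →
      T.rot (opp e) ≠ opp e → ht z < ht e - 1 := fun hz hcol hs =>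
    hc.ht_step hcol ▸ hc.ht_nextLeaf hz ((hc.col_step hs).trans hcol)
  induction h generalizing e' with
  | arrive e _ =>
    generalize hz : T.planeMap.opp e = z at h'
    cases h' with
    | arrive _ hs' => exact T.planeMap.opp_injective hz
    | go _ _ hs' hg =>
      have := hlt hg he' hs'
      rw [← hz, opp_planeMap, hc.ht_opp_of_col he] at this
      omega
  | go e z hs hg ih =>
    cases h' with
    | arrive _ hs' =>
      have := hlt hg he hs
      rw [opp_planeMap, hc.ht_opp_of_col he'] at this
      omega
    | go _ _ hs' hg' =>
      have := ih hg' ((hc.col_step hs).trans he) ((hc.col_step hs').trans he')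
        ((hc.ht_step he).trans (hht ▸ (hc.ht_step he').symm))
      exact T.planeMap.opp_injective (T.rot_injective this)

theorem exists_nextLeaf {e : T.Dart} (he : col e = true) : ∃ z, T.planeMap.NextLeaf e z := by
  obtain ⟨b, hb⟩ := (Set.finite_range ht).bddBelow
  generalize hm : (ht e - b).toNat = m
  induction m using Nat.strong_induction_on generalizing e with
  | _ m ih =>
    by_cases h : T.rot (opp e) = opp e
    · exact ⟨_, .arrive e h⟩
    · have h1 := hb ⟨T.rot (opp e), rfl⟩
      have h2 := hc.ht_step he
      obtain ⟨z, hz⟩ := ih _ (by omega) ((hc.col_step h).trans he) rfl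
      exact ⟨z, .go _ _ h hz⟩

/-- The walks from two half-edges to a leaf with the larger height at the start pass through the
same half-edges, so the walk from `e` passes through `x`, which is thus not a leaf. -/
theorem rot_ne_of_nextLeaf {x e z : T.Dart} (hx : T.planeMap.NextLeaf x z)
    (he : T.planeMap.NextLeaf e z) (hcx : col x = true) (hce : col e = true) (hlt : ht x < ht e) :
    T.rot x ≠ x := by
  induction he with
  | arrive e _ =>
    have h1 := hc.ht_nextLeaf hx hcx
    have h2 := hc.ht_opp_of_col hce
    rw [opp_planeMap] at h1
    omega
  | go e z he hz ih =>
    have hcol := (hc.col_step he).trans hce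
    have hstep := hc.ht_step hce
    rcases (show ht x ≤ ht (T.rot (opp e)) by omega).lt_or_eq with h | h
    · exact ih hx hcol h
    · rw [hc.eq_of_nextLeaf hx hz hcx hcol h]
      exact fun h' => he (T.rot_injective h')

section Leaves

variable {n : ℕ} (hn : T.vertexCount 1 + 1 = 2 * n) (hroot : col T.rootDart = true)
include hn hroot

theorem col_leafDart {i : ℕ} (hi : i < 2 * n) : col (T.leafDart i) = decide (Even i) := by
  induction i with
  | zero => exact hroot
  | succ i ih =>
    rw [hc.col_nextLeaf (T.nextLeaf_leafDart (i := i) (by omega)), ih (by omega)]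
    by_cases h : Even i <;> simp [h, Nat.even_add_one]

theorem col_headDart (k : Fin n) : col (T.headDart k) = true := by
  rw [headDart, hc.col_leafDart hn hroot (by omega)]; simp

theorem col_tailDart (k : Fin n) : col (T.tailDart k) = false := by
  rw [tailDart, hc.col_leafDart hn hroot (by omega)]; simp

end Leaves

end IsGraded

/-- The directed labelled graph on a tree with `2 n` leaves: `col` tells incoming from outgoing
half-edges, `ht` orders the vertices along the directed edges, and `lab` is the label of an edge,
which is the one of the leaf `t_k` at the end of the face on its left. -/
structure Labeling (n : ℕ) (T : PlantedTree) where
  col : T.Dart → Bool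
  ht : T.Dart → ℤ
  lab : T.Dart → Fin n
  vertexCount_one : T.vertexCount 1 + 1 = 2 * n
  isGraded : IsGraded col ht
  col_root : col T.rootDart = true
  lab_opp : ∀ x, lab (opp x) = lab x
  nextLeaf : ∀ x, col x = true → T.planeMap.NextLeaf x (T.tailDart (lab x))

theorem IsEven.nonempty_labeling {n : ℕ} [NeZero n] {T : PlantedTree} (hT : T.IsEven)
    (hn : T.vertexCount 1 + 1 = 2 * n) : Nonempty (Labeling n T) := by
  obtain ⟨col, hcol, hroot⟩ := hT.exists_isAlternating true
  obtain ⟨ht, hrot, hopp, -⟩ := T.exists_height (fun x => if col x then (-1 : ℤ) else 1)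
    (fun x => by cases h : col x <;> simp [hcol.col_opp, h]) 0
  have hc : IsGraded col ht := ⟨hcol, hrot, hopp⟩
  have hlab : ∀ x, ∃ k : Fin n, col x = true → T.planeMap.NextLeaf x (T.tailDart k) := by
    intro x
    by_cases hx : col x = true
    · obtain ⟨z, hz⟩ := hc.exists_nextLeaf hx
      obtain ⟨k, rfl | rfl⟩ := exists_headDart_or_tailDart hn hz.rot_eq
      · have := hc.col_nextLeaf hz
        rw [hc.col_headDart hn hroot, hx] at this
        cases this
      · exact ⟨k, fun _ => hz⟩
    · exact ⟨0, fun h => absurd h hx⟩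
  choose lab hlab using hlab
  refine ⟨⟨col, ht, fun x => lab (if col x then x else opp x), hn, hc, hroot, fun x => ?_,
    fun x hx => by simpa only [hx, if_true] using hlab x hx⟩⟩
  cases h : col x <;> simp [hcol.col_opp, h, opp_opp]

namespace Labeling

variable {n : ℕ} {T : PlantedTree} (L : Labeling n T)

theorem col_opp (x : T.Dart) : L.col (opp x) = !L.col x := L.isGraded.col_opp x

theorem col_rot {x : T.Dart} (hx : T.rot x ≠ x) : L.col (T.rot x) = !L.col x :=
  L.isGraded.col_rot x hx

theorem ht_opp {x : T.Dart} (hx : L.col x = true) : L.ht (opp x) = L.ht x - 1 :=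
  L.isGraded.ht_opp_of_col hx

theorem tailDart_lab_eq {x z : T.Dart} (hx : L.col x = true) (h : T.planeMap.NextLeaf x z) :
    T.tailDart (L.lab x) = z :=
  (L.nextLeaf x hx).unique h

theorem lab_eq_of_nextLeaf {x : T.Dart} {k : Fin n} (hx : L.col x = true)
    (h : T.planeMap.NextLeaf x (T.tailDart k)) : L.lab x = k :=
  tailDart_injective L.vertexCount_one (L.tailDart_lab_eq hx h)

theorem col_headDart (k : Fin n) : L.col (T.headDart k) = true :=
  L.isGraded.col_headDart L.vertexCount_one L.col_root k

theorem col_tailDart (k : Fin n) : L.col (T.tailDart k) = false :=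
  L.isGraded.col_tailDart L.vertexCount_one L.col_root k

theorem lab_headDart (k : Fin n) : L.lab (T.headDart k) = k :=
  L.lab_eq_of_nextLeaf (L.col_headDart k) (nextLeaf_headDart L.vertexCount_one k)

theorem lab_tailDart (k : Fin n) : L.lab (T.tailDart k) = k := by
  rw [← L.lab_opp]
  refine L.lab_eq_of_nextLeaf (by rw [L.col_opp, L.col_tailDart]; rfl) ?_
  have := NextLeaf.arrive (M := T.planeMap) (opp (T.tailDart k))
  rw [opp_planeMap, opp_opp] at this
  exact this (rot_tailDart L.vertexCount_one k)

theorem lab_rot {x : T.Dart} (hx : T.rot x ≠ x) (hcol : L.col x = false) :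
    L.lab (T.rot x) = L.lab x := by
  rw [← L.lab_opp x]
  refine (L.lab_eq_of_nextLeaf (by rw [L.col_opp, hcol]; rfl) (.go _ _ ?_ ?_)).symm <;>
    rw [opp_planeMap, opp_opp]
  · exact hx
  · exact L.nextLeaf _ (by rw [coe_rot_planeMap, L.col_rot hx, hcol]; rfl)

section Incoming

variable {L} {x y : T.Dart} (hx : L.col x = true) (hy : L.col y = true) (hlab : L.lab x = L.lab y)
include hx hy hlab

theorem eq_of_ht_eq (hht : L.ht x = L.ht y) : x = y :=
  L.isGraded.eq_of_nextLeaf (L.nextLeaf x hx) (hlab ▸ L.nextLeaf y hy) hx hy hht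

theorem ht_le_of_rot_opp_eq (h : T.rot (opp x) = opp x) : L.ht x ≤ L.ht y := by
  have hz : T.planeMap.NextLeaf y (opp x) := by
    have := L.tailDart_lab_eq hx (.arrive x h)
    rw [opp_planeMap] at this
    exact this ▸ hlab ▸ L.nextLeaf y hy
  have := L.isGraded.ht_nextLeaf hz hy
  rw [L.ht_opp hx] at this
  omega

theorem ht_le_of_rot_eq (h : T.rot x = x) : L.ht y ≤ L.ht x := by
  by_contra hlt
  exact L.isGraded.rot_ne_of_nextLeaf (L.nextLeaf x hx) (hlab ▸ L.nextLeaf y hy) hx hy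
    (not_le.1 hlt) h

theorem eq_or_eq_rot_opp (h : T.rot (opp x) ≠ opp x) (hle : L.ht (opp x) ≤ L.ht y)
    (hge : L.ht y ≤ L.ht x) : y = x ∨ y = T.rot (opp x) := by
  rw [L.ht_opp hx] at hle
  rcases hge.lt_or_eq with hlt | heq
  · refine .inr (eq_of_ht_eq hy ((L.isGraded.col_step h).trans hx) ?_ ?_)
    · rw [L.lab_rot h (by rw [L.col_opp, hx]; rfl), L.lab_opp, hlab]
    · rw [L.isGraded.ht_step hx]
      omega
  · exact .inl (eq_of_ht_eq hy hx hlab.symm heq)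

end Incoming

end Labeling

end PlantedTree

namespace PlantedTree

open PlaneMap

/-! ### The factorization of a tree -/

namespace Labeling

variable {n : ℕ} {T : PlantedTree} (L : Labeling n T)

theorem col_rot_rot (x : T.Dart) : L.col (T.rot (T.rot x)) = L.col x := by
  by_cases h : T.rot x = x
  · rw [h, h]
  · rw [L.col_rot (T.rot_injective.ne h), L.col_rot h, Bool.not_not]

theorem injective_lab (v : T.planeMap.Vertex) : Function.Injective
    fun x : {x // T.planeMap.vertex x = v ∧ L.col x = true} => L.lab x := fun x y h =>
  Subtype.ext <| eq_of_ht_eq x.2.2 y.2.2 h <| L.isGraded.ht_eq (x.2.1.trans y.2.1.symm)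

/-- The cycle of the labels of the incoming half-edges at the vertex `v`, in counterclockwise
order. -/
noncomputable def cycle (v : T.planeMap.Vertex) : Equiv.Perm (Fin n) :=
  ((T.planeMap.rot * T.planeMap.rot).subtypePerm
    (p := fun x => T.planeMap.vertex x = v ∧ L.col x = true) fun x => by
      rw [Equiv.Perm.mul_apply, vertex_rot, vertex_rot, coe_rot_planeMap,
        L.col_rot_rot]).viaEmbedding ⟨fun x => L.lab x, L.injective_lab v⟩

theorem cycle_apply_lab {x : T.Dart} (hx : L.col x = true) :
    L.cycle (T.planeMap.vertex x) (L.lab x) = L.lab (T.rot (T.rot x)) :=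
  Equiv.Perm.viaEmbedding_apply _ ⟨_, L.injective_lab (T.planeMap.vertex x)⟩ ⟨x, rfl, hx⟩

theorem exists_lab_eq_of_cycle_apply_ne {v : T.planeMap.Vertex} {k : Fin n} (h : L.cycle v k ≠ k) :
    ∃ x, T.planeMap.vertex x = v ∧ L.col x = true ∧ L.lab x = k := by
  by_contra! hk
  refine h (Equiv.Perm.viaEmbedding_apply_of_notMem _ _ k ?_)
  rintro ⟨x, rfl⟩
  exact hk x x.2.1 x.2.2 rfl

theorem cycle_iterate_apply_lab {x : T.Dart} (hx : L.col x = true) (m : ℕ) :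
    (L.cycle (T.planeMap.vertex x) ^ m) (L.lab x) = L.lab (T.rot^[2 * m] x) ∧
      L.col (T.rot^[2 * m] x) = true := by
  induction m with
  | zero => exact ⟨rfl, hx⟩
  | succ m ih =>
    have hv : T.planeMap.vertex (T.rot^[2 * m] x) = T.planeMap.vertex x :=
      T.planeMap.vertex_iterate_rot _ _
    rw [pow_succ', Equiv.Perm.mul_apply, ih.1, ← hv, L.cycle_apply_lab ih.2, Nat.mul_succ,
      Function.iterate_succ_apply', Function.iterate_succ_apply', L.col_rot_rot]
    exact ⟨rfl, ih.2⟩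

theorem exists_incoming {x : T.Dart} (hx : T.rot x ≠ x) : ∃ y, T.rot y ≠ y ∧ L.col y = true ∧
    T.planeMap.vertex y = T.planeMap.vertex x := by
  cases hcol : L.col x with
  | true => exact ⟨x, hx, hcol, rfl⟩
  | false =>
    exact ⟨T.rot x, T.rot_injective.ne hx, by rw [L.col_rot hx, hcol]; rfl,
      T.planeMap.vertex_rot x⟩

theorem rot_ne_of_vertex_eq {x y : T.Dart} (hx : T.rot x ≠ x)
    (h : T.planeMap.vertex x = T.planeMap.vertex y) : T.rot y ≠ y := by
  obtain ⟨m, rfl⟩ := T.planeMap.vertex_eq_vertex_iff_exists_iterate.1 h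
  exact (Function.iterate_succ_apply' T.rot m x).symm.trans_ne ((T.rot_injective.iterate m).ne hx)

section NoDegreeTwo

variable (hT : ∀ x, T.rot x ≠ x → T.rot (T.rot x) ≠ x)
include hT

theorem cycle_apply_lab_ne {x : T.Dart} (hx : T.rot x ≠ x) :
    L.cycle (T.planeMap.vertex x) (L.lab x) ≠ L.lab x := by
  have key : ∀ {x}, T.rot x ≠ x → L.col x = true →
      L.cycle (T.planeMap.vertex x) (L.lab x) ≠ L.lab x := fun {x} hx hcol h => by
    rw [L.cycle_apply_lab hcol] at h
    exact hT x hx <| eq_of_ht_eq ((L.col_rot_rot x).trans hcol) hcol h <| by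
      rw [L.isGraded.ht_rot, L.isGraded.ht_rot]
  cases hcol : L.col x with
  | true => exact key hx hcol
  | false =>
    have := key (T.rot_injective.ne hx) (by rw [L.col_rot hx, hcol]; rfl)
    rwa [L.lab_rot hx hcol, ← coe_rot_planeMap, vertex_rot] at this

theorem isCycle_cycle {x : T.Dart} (hx : T.rot x ≠ x) :
    (L.cycle (T.planeMap.vertex x)).IsCycle := by
  obtain ⟨x, hx, hcol, hv⟩ := L.exists_incoming hx
  rw [← hv]
  refine ⟨L.lab x, L.cycle_apply_lab_ne hT hx, fun k hk => ?_⟩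
  obtain ⟨y, hy, hcy, rfl⟩ := L.exists_lab_eq_of_cycle_apply_ne hk
  obtain ⟨m, rfl⟩ := T.planeMap.vertex_eq_vertex_iff_exists_iterate.1 hy.symm
  obtain ⟨m, rfl | rfl⟩ := m.even_or_odd'
  · exact ⟨m, (L.cycle_iterate_apply_lab hcol m).1⟩
  · have h := (L.cycle_iterate_apply_lab hcol m).2
    rw [coe_rot_planeMap, Function.iterate_succ_apply', L.col_rot, h] at hcy
    · cases hcy
    · exact rot_ne_of_vertex_eq hx (T.planeMap.vertex_iterate_rot _ _).symm

end NoDegreeTwo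

end Labeling

/-- The vertices that are not leaves. -/
def Inner (T : PlantedTree) : Type := {v : T.planeMap.Vertex // ∃ x, T.rot x ≠ x ∧
  T.planeMap.vertex x = v}

instance (T : PlantedTree) : Finite T.Inner :=
  inferInstanceAs (Finite {v : T.planeMap.Vertex // ∃ x, T.rot x ≠ x ∧ T.planeMap.vertex x = v})

/-- The vertex that carries a half-edge, if it is not a leaf. -/
noncomputable def inner {T : PlantedTree} (x : T.Dart) (hx : T.rot x ≠ x) : T.Inner :=
  ⟨T.planeMap.vertex x, x, hx, rfl⟩

theorem exists_equiv_inner_monotone (T : PlantedTree) (h : T.Inner → ℤ) :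
    ∃ (m : ℕ) (w : Fin m ≃ T.Inner), Monotone (h ∘ w) :=
  let e := (Finite.equivFin T.Inner).symm
  ⟨_, (Tuple.sort (h ∘ e)).trans e, Tuple.monotone_sort (h ∘ e)⟩

namespace Labeling

variable {n : ℕ} {T : PlantedTree} (L : Labeling n T) {l : List (Equiv.Perm (Fin n))}

/-- The list `l` consists of the cycles at the vertices of the tree that are not leaves, in an
order, given by `w`, along which the height does not decrease. -/
structure IsReading (w : Fin l.length ≃ T.Inner) : Prop where
  rot_rot_ne : ∀ x, T.rot x ≠ x → T.rot (T.rot x) ≠ x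
  get_eq : ∀ i, l.get i = L.cycle (w i).1
  ht_le : ∀ x y hx hy, w.symm (inner x hx) ≤ w.symm (inner y hy) → L.ht x ≤ L.ht y

theorem exists_isReading (hT : ∀ x, T.rot x ≠ x → T.rot (T.rot x) ≠ x) :
    ∃ (l : List (Equiv.Perm (Fin n))) (w : Fin l.length ≃ T.Inner), L.IsReading w := by
  obtain ⟨m, w, hw⟩ := T.exists_equiv_inner_monotone fun v => L.ht v.1.out
  have hlen : (List.ofFn fun i => L.cycle (w i).1).length = m := List.length_ofFn
  refine ⟨List.ofFn fun i => L.cycle (w i).1, (finCongr hlen).trans w, hT, fun i => ?_,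
    fun x y hx hy hle => ?_⟩
  · rw [List.get_ofFn]
    rfl
  · have hout : ∀ x hx, L.ht (inner x hx).1.out = L.ht x := fun x hx =>
      L.isGraded.ht_eq (Quotient.out_eq _)
    have := hw (show w.symm (inner x hx) ≤ w.symm (inner y hy) from hle)
    simpa only [Function.comp_apply, Equiv.apply_symm_apply, hout] using this

namespace IsReading

variable {L} {w : Fin l.length ≃ T.Inner} (hw : L.IsReading w)
include hw

theorem get_eq_cycle {x : T.Dart} (hx : T.rot x ≠ x) :
    l.get (w.symm (inner x hx)) = L.cycle (T.planeMap.vertex x) := by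
  rw [hw.get_eq, w.apply_symm_apply]
  rfl

theorem get_apply_lab_ne {x : T.Dart} (hx : T.rot x ≠ x) :
    l.get (w.symm (inner x hx)) (L.lab x) ≠ L.lab x := by
  rw [hw.get_eq_cycle hx]
  exact L.cycle_apply_lab_ne hw.rot_rot_ne hx

theorem exists_lab_eq {i : Fin l.length} {k : Fin n} (h : l.get i k ≠ k) :
    ∃ x hx, L.col x = true ∧ L.lab x = k ∧ w.symm (inner x hx) = i := by
  rw [hw.get_eq] at h
  obtain ⟨x, hv, hcol, hlab⟩ := L.exists_lab_eq_of_cycle_apply_ne h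
  obtain ⟨y, hy, hyv⟩ := (w i).2
  exact ⟨x, rot_ne_of_vertex_eq hy (hyv.trans hv.symm), hcol, hlab,
    w.symm_apply_eq.2 (Subtype.ext hv)⟩

theorem isCycle {σ : Equiv.Perm (Fin n)} (hσ : σ ∈ l) : σ.IsCycle := by
  obtain ⟨i, rfl⟩ := List.get_of_mem hσ
  obtain ⟨x, hx, hv⟩ := (w i).2
  rw [hw.get_eq, ← hv]
  exact L.isCycle_cycle hw.rot_rot_ne hx

open Classical in
/-- The half-edge of the graph of the product that has the same vertex, direction and label. -/
noncomputable def toProductDart (x : T.Dart) : ProductDart l :=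
  if hx : T.rot x = x then bif L.col x then .head (L.lab x) else .tail (L.lab x)
  else bif L.col x then .inc _ _ (hw.get_apply_lab_ne hx) else .out _ _ (hw.get_apply_lab_ne hx)

section Cases

variable {x : T.Dart}

theorem toProductDart_head (hx : T.rot x = x) (hcol : L.col x = true) :
    hw.toProductDart x = .head (L.lab x) := by
  simp [toProductDart, hx, hcol]

theorem toProductDart_tail (hx : T.rot x = x) (hcol : L.col x = false) :
    hw.toProductDart x = .tail (L.lab x) := by
  simp [toProductDart, hx, hcol]

theorem toProductDart_inc (hx : T.rot x ≠ x) (hcol : L.col x = true) :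
    hw.toProductDart x = .inc _ _ (hw.get_apply_lab_ne hx) := by
  simp [toProductDart, hx, hcol]

theorem toProductDart_out (hx : T.rot x ≠ x) (hcol : L.col x = false) :
    hw.toProductDart x = .out _ _ (hw.get_apply_lab_ne hx) := by
  simp [toProductDart, hx, hcol]

end Cases

theorem toProductDart_rot (x : T.Dart) :
    hw.toProductDart (T.rot x) = (hw.toProductDart x).rot := by
  by_cases hx : T.rot x = x
  · cases hcol : L.col x with
    | true => rw [hx, hw.toProductDart_head hx hcol]; rfl
    | false => rw [hx, hw.toProductDart_tail hx hcol]; rfl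
  · have hx' := T.rot_injective.ne hx
    have hv : inner (T.rot x) hx' = inner x hx := Subtype.ext (T.planeMap.vertex_rot x)
    cases hcol : L.col x with
    | true =>
      have hcol' : L.col (T.rot x) = false := by rw [L.col_rot hx, hcol]; rfl
      rw [hw.toProductDart_inc hx hcol, hw.toProductDart_out hx' hcol', ProductDart.rot]
      simp only [hv, hw.get_eq_cycle hx, L.cycle_apply_lab hcol, L.lab_rot hx' hcol']
    | false =>
      have hcol' : L.col (T.rot x) = true := by rw [L.col_rot hx, hcol]; rfl
      rw [hw.toProductDart_out hx hcol, hw.toProductDart_inc hx' hcol', ProductDart.rot]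
      simp only [hv, L.lab_rot hx hcol]

theorem toProductDart_ne_rot {x : T.Dart} (hx : T.rot x ≠ x) :
    (hw.toProductDart x).rot ≠ hw.toProductDart x := by
  cases hcol : L.col x with
  | true => rw [hw.toProductDart_inc hx hcol, ProductDart.rot]; exact nofun
  | false => rw [hw.toProductDart_out hx hcol, ProductDart.rot]; exact nofun

theorem arrow_toProductDart {x : T.Dart} (hx : L.col x = true) :
    (hw.toProductDart (opp x)).Arrow (hw.toProductDart x) := by
  have hcol : L.col (opp x) = false := by rw [L.col_opp, hx]; rfl
  by_cases hl : T.rot x = x <;> by_cases hl' : T.rot (opp x) = opp x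
  · rw [hw.toProductDart_head hl hx, hw.toProductDart_tail hl' hcol, L.lab_opp]
    refine .tail_head _ fun r => by_contra fun hr => ?_
    obtain ⟨y, hy, hcy, hlab, rfl⟩ := hw.exists_lab_eq hr
    have := eq_of_ht_eq hx hcy hlab.symm <|
      (ht_le_of_rot_opp_eq hx hcy hlab.symm hl').antisymm (ht_le_of_rot_eq hx hcy hlab.symm hl)
    exact hy (this ▸ hl)
  · rw [hw.toProductDart_head hl hx, hw.toProductDart_out hl' hcol]
    simp only [L.lab_opp]
    refine .out_head _ _ _ fun r hr => by_contra fun hr' => ?_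
    obtain ⟨y, hy, hcy, hlab, rfl⟩ := hw.exists_lab_eq hr'
    obtain rfl | rfl := eq_or_eq_rot_opp hx hcy hlab.symm hl' (hw.ht_le _ _ _ _ hr.le)
      (ht_le_of_rot_eq hx hcy hlab.symm hl)
    · exact hy hl
    · exact hr.ne (congrArg w.symm (Subtype.ext (T.planeMap.vertex_rot _).symm))
  · rw [hw.toProductDart_inc hl hx, hw.toProductDart_tail hl' hcol, L.lab_opp]
    refine .tail_inc _ _ _ fun r hr => by_contra fun hr' => ?_
    obtain ⟨y, hy, hcy, hlab, rfl⟩ := hw.exists_lab_eq hr'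
    obtain rfl := eq_of_ht_eq hx hcy hlab.symm <|
      (ht_le_of_rot_opp_eq hx hcy hlab.symm hl').antisymm (hw.ht_le _ _ _ _ hr.le)
    exact hr.ne rfl
  · rw [hw.toProductDart_inc hl hx, hw.toProductDart_out hl' hcol]
    simp only [L.lab_opp]
    refine .out_inc _ _ _ _ _ (not_le.1 fun hle => ?_) fun r hr hr' => by_contra fun hr'' => ?_
    · have := hw.ht_le _ _ _ _ hle
      rw [L.ht_opp hx] at this
      omega
    · obtain ⟨y, hy, hcy, hlab, rfl⟩ := hw.exists_lab_eq hr''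
      obtain rfl | rfl := eq_or_eq_rot_opp hx hcy hlab.symm hl' (hw.ht_le _ _ _ _ hr.le)
        (hw.ht_le _ _ _ _ hr'.le)
      · exact hr'.ne rfl
      · exact hr.ne (congrArg w.symm (Subtype.ext (T.planeMap.vertex_rot _).symm))

theorem isHom_toProductDart : IsHom T.planeMap (ProductDart.planeMap l) hw.toProductDart where
  map_rot := hw.toProductDart_rot
  map_opp x := by
    cases hcol : L.col x with
    | true => exact (hw.arrow_toProductDart hcol).opp_eq'.symm
    | false =>
      have := (hw.arrow_toProductDart (x := opp x) (by rw [L.col_opp, hcol]; rfl)).opp_eq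
      rw [opp_opp] at this
      exact this.symm

theorem toProductDart_headDart (k : Fin n) : hw.toProductDart (T.headDart k) = .head k := by
  rw [hw.toProductDart_head (rot_headDart L.vertexCount_one k) (L.col_headDart k), L.lab_headDart]

theorem toProductDart_tailDart (k : Fin n) : hw.toProductDart (T.tailDart k) = .tail k := by
  rw [hw.toProductDart_tail (rot_tailDart L.vertexCount_one k) (L.col_tailDart k), L.lab_tailDart]

theorem prod_eq : l.reverse.prod = finRotate n := by
  refine Equiv.ext fun k => ?_
  have h := (nextLeaf_tailDart L.vertexCount_one k).map hw.isHom_toProductDart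
    fun x => not_imp_not.1 hw.toProductDart_ne_rot
  rw [hw.toProductDart_headDart, hw.toProductDart_tailDart] at h
  exact ProductDart.head.inj ((ProductDart.nextLeaf_tail k).unique h)

theorem isTreeOfProduct [NeZero n] : T.IsTreeOfProduct l := by
  have hroot : ∀ x, hw.toProductDart x = .head 0 ↔ x = T.rootDart := by
    refine fun x => ⟨fun hx => ?_, fun hx => hx ▸ hw.toProductDart_headDart 0⟩
    have hleaf : T.rot x = x := not_imp_not.1 hw.toProductDart_ne_rot (by rw [hx, ProductDart.rot])
    obtain ⟨k, rfl | rfl⟩ := exists_headDart_or_tailDart L.vertexCount_one hleaf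
    · rw [hw.toProductDart_headDart, ProductDart.head.injEq] at hx
      rw [hx]
      rfl
    · rw [hw.toProductDart_tailDart] at hx
      cases hx
  have hbij := bijective_of_isHom hw.isHom_toProductDart
    (ProductDart.isConnectedFrom_head_zero hw.prod_eq) hroot
  exact isTreeOfProduct_iff.2 ⟨.ofBijective _ hbij, hw.isHom_toProductDart, (hroot _).2 rfl⟩

end IsReading

end Labeling

namespace HasType

variable {n : ℕ} {α : ℕ →₀ ℕ} {T : PlantedTree} (hT : T.HasType n α)
include hT

theorem rot_rot_ne {x : T.Dart} (hx : T.rot x ≠ x) : T.rot (T.rot x) ≠ x := by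
  intro h2
  have hle : Function.minimalPeriod T.rot x ≤ 2 :=
    Function.IsPeriodicPt.minimalPeriod_le (n := 2) (by omega) h2
  have hne : Function.minimalPeriod T.rot x ≠ 1 := fun h =>
    hx (Function.minimalPeriod_eq_one_iff_isFixedPt.1 h)
  have hcard := T.card_minimalPeriod (Function.minimalPeriod T.rot x)
  have : Nonempty {y // Function.minimalPeriod T.rot y = Function.minimalPeriod T.rot x} :=
    ⟨⟨x, rfl⟩⟩
  have hpos : 0 < Nat.card {y // Function.minimalPeriod T.rot y = Function.minimalPeriod T.rot x} :=
    Nat.card_pos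
  rw [hcard, if_neg hne, add_zero] at hpos
  obtain h | ⟨j, hj, h⟩ := hT.only _ (Nat.pos_of_mul_pos_left hpos).ne' <;> omega

theorem isEven : T.IsEven := fun d hd => by
  obtain h | ⟨j, -, rfl⟩ := hT.only d hd
  exacts [.inl h, .inr (even_two_mul j)]

theorem exists_isTreeOfProduct [NeZero n] : ∃ l : List (Equiv.Perm (Fin n)),
    IsMinimalFactorization n α l ∧ T.IsTreeOfProduct l := by
  obtain ⟨L⟩ := hT.isEven.nonempty_labeling hT.leaves
  obtain ⟨l, w, hw⟩ := L.exists_isReading fun _ => hT.rot_rot_ne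
  exact ⟨l, hw.isTreeOfProduct.isMinimalFactorization hT (fun _ => hw.isCycle) hw.prod_eq,
    hw.isTreeOfProduct⟩

end HasType

end PlantedTree

namespace PlantedTree

open PlaneMap ProductDart

/-! ### Stripping the tree of a product -/

section Order

variable {n : ℕ} {l : List (Equiv.Perm (Fin n))}

/-- An edge of the plane graph of the product leads from the `i`-th to the `j`-th factor. -/
def Precedes (i j : Fin l.length) : Prop :=
  ∃ k hi hj, Arrow (.out i k hi) (.inc j k hj)

theorem Precedes.lt {i j : Fin l.length} (h : Precedes i j) : i < j := by
  obtain ⟨_, _, _, h⟩ := h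
  cases h
  assumption

theorem arrow_tail_inc_or_exists_arrow_out_inc (j : Fin l.length) (k : Fin n) (hj) :
    Arrow (.tail k : ProductDart l) (.inc j k hj) ∨
      ∃ i hi, Arrow (.out i k hi : ProductDart l) (.inc j k hj) := by
  have h := arrow_opp (.inc j k hj)
  generalize (ProductDart.inc j k hj).opp = d at h
  rcases h with h | h
  · cases h
  · cases h with
    | tail_inc _ _ _ h => exact .inl (.tail_inc j k hj h)
    | out_inc i _ _ hi _ hij h => exact .inr ⟨i, hi, .out_inc i j k hi hj hij h⟩

theorem arrow_out_head_or_exists_arrow_out_inc (i : Fin l.length) (k : Fin n) (hi) :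
    Arrow (.out i k hi : ProductDart l) (.head k) ∨
      ∃ j hj, Arrow (.out i k hi : ProductDart l) (.inc j k hj) := by
  have h := arrow_opp (.out i k hi)
  generalize (ProductDart.out i k hi).opp = d at h
  rcases h with h | h
  · cases h with
    | out_inc _ j _ _ hj hij h => exact .inr ⟨j, hj, .out_inc i j k hi hj hij h⟩
    | out_head _ _ _ h => exact .inl (.out_head i k hi h)
  · cases h

/-- All factors that precede the `i`-th one are in `G`, but not this one itself. -/
def Ready (G : Set (Fin l.length)) (i : Fin l.length) : Prop :=
  i ∉ G ∧ ∀ j, Precedes j i → j ∈ G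

theorem exists_ready {G : Set (Fin l.length)} (h : G ≠ Set.univ) : ∃ i, Ready G i := by
  obtain ⟨i, hi, hmin⟩ := exists_minimal_of_wellFoundedLT (· ∉ G)
    ((Set.ne_univ_iff_exists_notMem G).1 h)
  exact ⟨i, hi, fun j hj => not_not.1 fun hjG => (hmin hjG hj.lt.le).not_gt hj.lt⟩

theorem mem_of_lt_of_moved {G : Set (Fin l.length)} (hG : ∀ i j, Precedes i j → j ∈ G → i ∈ G)
    {i j : Fin l.length} {k : Fin n} (hij : i < j) (hi : l.get i k ≠ k) (hj : l.get j k ≠ k)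
    (hjG : ∀ r, Precedes r j → r ∈ G) : i ∈ G := by
  induction j using WellFoundedLT.induction with
  | ind j ih =>
    rcases arrow_tail_inc_or_exists_arrow_out_inc j k hj with h | ⟨r, hr, h⟩
    · cases h with
      | tail_inc _ _ _ h => exact absurd (h i hij) hi
    · have hrj : Precedes r j := ⟨k, hr, hj, h⟩
      have hrG := hjG r hrj
      rcases lt_trichotomy i r with hir | rfl | hir
      · exact ih r hrj.lt hir hr fun q hq => hG q r hq hrG
      · exact hrG
      · cases h with
        | out_inc _ _ _ _ _ _ h => exact absurd (h i hir hij) hi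

open Classical in
/-- The factors whose indices are not in `G`, in their order. -/
noncomputable def remaining (G : Set (Fin l.length)) : List (Equiv.Perm (Fin n)) :=
  ((List.finRange l.length).filter (· ∉ G)).map l.get

theorem remaining_empty : remaining (∅ : Set (Fin l.length)) = l := by
  simp [remaining]

theorem remaining_univ : remaining (Set.univ : Set (Fin l.length)) = [] := by
  simp [remaining]

theorem exists_remaining_insert_eq {G : Set (Fin l.length)} {i : Fin l.length} (hi : i ∉ G) :
    ∃ a b : List (Fin l.length), (∀ j ∈ a, j ∉ G ∧ j < i) ∧
      remaining G = a.map l.get ++ l.get i :: b.map l.get ∧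
      remaining (insert i G) = a.map l.get ++ b.map l.get := by
  classical
  let L := (List.finRange l.length).filter (· ∉ G)
  have hmem : ∀ j, j ∈ L ↔ j ∉ G := by simp [L]
  have hsorted : L.Pairwise (· < ·) := (List.pairwise_lt_finRange _).filter _
  have herase : (List.finRange l.length).filter (· ∉ insert i G) = L.erase i := by
    rw [List.Nodup.erase_eq_filter (hsorted.imp ne_of_lt), List.filter_filter]
    exact List.filter_congr fun j _ => by simp [bne, Bool.beq_eq_decide_eq]
  obtain ⟨a, b, -, hL, hab⟩ := List.exists_erase_eq ((hmem i).2 hi)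
  refine ⟨a, b, fun j hj => ⟨(hmem j).1 (by rw [hL]; exact List.mem_append_left _ hj), ?_⟩, ?_, ?_⟩
  · rw [hL, List.pairwise_append] at hsorted
    exact hsorted.2.2 j hj i List.mem_cons_self
  · rw [remaining, ← List.map_cons, ← List.map_append, ← hL]
  · rw [remaining, ← List.map_append, ← hab, ← herase]
    congr!

theorem eqvGen_remaining {G : Set (Fin l.length)} (hG : ∀ i j, Precedes i j → j ∈ G → i ∈ G)
    {i : Fin l.length} (hi : Ready G i) :
    Relation.EqvGen CommutationMove (remaining G) (l.get i :: remaining (insert i G)) := by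
  obtain ⟨a, b, ha, hrem, hins⟩ := exists_remaining_insert_eq hi.1
  rw [hrem, hins]
  refine CommutationMove.eqvGen_middle fun τ hτ => ?_
  obtain ⟨j, hj, rfl⟩ := List.mem_map.1 hτ
  refine Equiv.Perm.Disjoint.commute fun k => ?_
  by_contra! hk
  exact (ha j hj).1 (mem_of_lt_of_moved hG (ha j hj).2 hk.1 hk.2 hi.2)

end Order

section Leaves

variable {n : ℕ} {l : List (Equiv.Perm (Fin n))} {T : PlantedTree}
  (hn : T.vertexCount 1 + 1 = 2 * n)
include hn

theorem initialStage_lab (e : T.Dart) (k : Fin n) :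
    (initialStage n T).lab e k ↔ opp e = T.tailDart k := by
  have hk : 2 * (k : ℕ) < T.leaves.length := by rw [length_leaves]; omega
  have h : T.tailDart k = .up (T.leaves[2 * (k : ℕ)]) := by
    simp [tailDart, leafDart, leafDarts, hk]
  simp only [initialStage, List.getElem?_eq_getElem hk, Option.some.injEq, exists_eq_left', h]

theorem map_tail_eq_tailDart [NeZero n] (hprod : l.reverse.prod = finRotate n)
    {φ : ProductDart l ≃ T.Dart} (hφ : IsHom (ProductDart.planeMap l) T.planeMap φ)
    (hroot : φ (.head 0) = T.rootDart) (k : Fin n) : φ (.tail k) = T.tailDart k := by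
  have hfix : ∀ d, T.rot (φ d) = φ d → d.rot = d := fun d hd =>
    φ.injective ((hφ.map_rot d).trans hd)
  have htail : ∀ k, φ (.head k) = T.headDart k → φ (.tail k) = T.tailDart k := fun k hk =>
    (hk ▸ (nextLeaf_head k).map hφ hfix).unique (nextLeaf_headDart hn k)
  have hhead : ∀ k, φ (.head k) = T.headDart k →
      φ (.head (finRotate n k)) = T.headDart (finRotate n k) := fun k hk =>
    (hprod ▸ htail k hk ▸ (nextLeaf_tail k).map hφ hfix).unique (nextLeaf_tailDart hn k)
  suffices ∀ m (hm : m < n), φ (.head ⟨m, hm⟩) = T.headDart ⟨m, hm⟩ from htail k (this k k.2)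
  intro m hm
  induction m with
  | zero => exact hroot
  | succ m ih =>
    have := hhead ⟨m, by omega⟩ (ih _)
    rwa [show finRotate n ⟨m, by omega⟩ = ⟨m + 1, hm⟩ from
      Fin.ext (by rw [val_finRotate, Nat.mod_eq_of_lt hm])] at this

end Leaves

theorem ncard_star {T : PlantedTree} (x : T.Dart) :
    (star x).ncard = Function.minimalPeriod T.rot x := by
  rw [← coe_rot_planeMap, PlaneMap.minimalPeriod_rot]
  exact congrArg Set.ncard (Set.ext fun _ => mem_star_iff)

theorem Stage.IsFactor.unique {n : ℕ} {T : PlantedTree} {s : Stage n T} {x : T.Dart}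
    {σ τ : Equiv.Perm (Fin n)} (hσ : s.IsFactor x σ) (hτ : s.IsFactor x τ)
    (hlab : ∀ e ∈ star x, ∀ k k', s.lab e k → s.lab e k' → k = k') : σ = τ := by
  ext k : 1
  by_cases hk : ∃ e ∈ star x, s.lab e k
  · obtain ⟨e, ⟨m, rfl⟩, hek⟩ := hk
    obtain ⟨r, hr, hσr, hσ'⟩ := hσ.1 _ ⟨m, rfl⟩ k hek
    obtain ⟨q, hq, hτq, hτ'⟩ := hτ.1 _ ⟨m, rfl⟩ k hek
    obtain rfl : r = q := le_antisymm (not_lt.1 fun h => hσ' q hq h _ hτq)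
      (not_lt.1 fun h => hτ' r hr h _ hσr)
    exact hlab _ ⟨r + m, Function.iterate_add_apply _ _ _ _⟩ _ _ hσr hτq
  · push Not at hk
    rw [hσ.2 k hk, hτ.2 k hk]

section Stripped

variable {n : ℕ} {l : List (Equiv.Perm (Fin n))} {T : PlantedTree}

/-- The half-edges that are gone and the labels at a stage of the stripping procedure in which the
factors with indices in `G` have been removed. -/
structure Stripped (φ : ProductDart l ≃ T.Dart) (s : Stage n T) (G : Set (Fin l.length)) :
    Prop where
  mem_of_precedes : ∀ i j, Precedes i j → j ∈ G → i ∈ G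
  gone : ∀ d, φ d ∈ s.gone ↔ ∃ i ∈ G, d.vtx = .inr i
  lab_inc : ∀ j ∉ G, ∀ k hk k', s.lab (φ (.inc j k hk)) k' ↔
    k' = k ∧ ∀ i hi, Arrow (.out i k hi) (.inc j k hk) → i ∈ G
  lab_out : ∀ j ∉ G, ∀ k hk k', ¬ s.lab (φ (.out j k hk)) k'

variable {φ : ProductDart l ≃ T.Dart}

theorem Stripped.lab_inc_of_ready {s : Stage n T} {G : Set (Fin l.length)} (h : Stripped φ s G)
    {i : Fin l.length} (hi : Ready G i) {k : Fin n} (hk : l.get i k ≠ k) (k' : Fin n) :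
    s.lab (φ (.inc i k hk)) k' ↔ k' = k := by
  rw [h.lab_inc i hi.1, and_iff_left fun j hj ha => hi.2 j ⟨k, hj, hk, ha⟩]

variable (hφ : IsHom (ProductDart.planeMap l) T.planeMap φ)
include hφ

theorem stripped_initialStage (hn : T.vertexCount 1 + 1 = 2 * n)
    (htail : ∀ k, φ (.tail k) = T.tailDart k) : Stripped φ (initialStage n T) ∅ := by
  have hlab : ∀ d k, (initialStage n T).lab (φ d) k ↔ d.opp = .tail k := fun d k => by
    rw [initialStage_lab hn, ← htail, ← φ.apply_eq_iff_eq]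
    exact iff_of_eq (congrArg (· = _) (hφ.map_opp d).symm)
  refine ⟨fun _ _ _ => id, fun d => by simp [initialStage], fun j _ k hk k' => ?_,
    fun j _ k hk k' => ?_⟩
  · rw [hlab]
    rcases arrow_tail_inc_or_exists_arrow_out_inc j k hk with h | ⟨i, hi, h⟩
    · have hnot : ∀ i hi, ¬ Arrow (.out i k hi) (.inc j k hk) := fun i hi h' => by
        cases h.left_unique h'
      simp [h.opp_eq', hnot, eq_comm]
    · simpa [h.opp_eq'] using fun _ => ⟨i, hi, h⟩
  · rw [hlab, opp_eq_iff]
    rintro (h | h) <;> cases h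

variable (hl : ∀ σ ∈ l, σ.IsCycle)
include hl

theorem map_mem_star_iff {d d' : ProductDart l} : φ d' ∈ star (φ d) ↔ d'.vtx = d.vtx := by
  rw [eq_comm, ← ProductDart.vertex_eq_vertex_iff hl, vertex_eq_vertex_iff_exists_iterate]
  refine exists_congr fun m => ?_
  rw [← φ.apply_eq_iff_eq, hφ.map_iterate_rot, coe_rot_planeMap]

theorem ncard_star_map {d : ProductDart l} {i : Fin l.length} (hd : d.vtx = .inr i) :
    (star (φ d)).ncard = 2 * (l.get i).support.card := by
  rw [ncard_star, ← coe_rot_planeMap, hφ.minimalPeriod_eq φ.injective,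
    ProductDart.coe_rot_planeMap, ProductDart.minimalPeriod_rot hl, hd, deg]

theorem remove_lab_iff (s : Stage n T) {d : ProductDart l} {i : Fin l.length} (hd : d.vtx = .inr i)
    {d' d'' : ProductDart l} (hopp : d'.opp = d'') (k : Fin n) :
    (s.remove (φ d)).lab (φ d') k ↔
      (d''.vtx = .inr i ∧ s.lab (φ d''.rot) k) ∨ (d''.vtx ≠ .inr i ∧ s.lab (φ d') k) := by
  have h1 : opp (φ d') = φ d'' := hopp ▸ (hφ.map_opp d').symm
  have h2 : T.rot (φ d'') = φ d''.rot := (hφ.map_rot d'').symm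
  simp only [Stage.remove, h1, h2, map_mem_star_iff hφ hl, hd, ne_eq]

namespace Stripped

variable {s : Stage n T} {G : Set (Fin l.length)} (h : Stripped φ s G)
include h

theorem lab_iff {d : ProductDart l} {i : Fin l.length} (hd : d.vtx = .inr i) (hi : i ∉ G)
    {e : T.Dart} (he : e ∈ star (φ d)) {k : Fin n} : s.lab e k ↔
      ∃ hk, e = φ (.inc i k hk) ∧ ∀ j hj, Arrow (.out j k hj) (.inc i k hk) → j ∈ G := by
  obtain ⟨d', rfl⟩ := φ.surjective e
  rw [map_mem_star_iff hφ hl, hd] at he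
  cases d' with
  | tail => cases he
  | head => cases he
  | inc j k' hk' =>
    obtain rfl : j = i := Sum.inr.inj he
    rw [h.lab_inc j hi]
    constructor
    · rintro ⟨rfl, h'⟩
      exact ⟨hk', rfl, h'⟩
    · rintro ⟨hk, hkk, h'⟩
      cases φ.injective hkk
      exact ⟨rfl, h'⟩
  | out j k' hk' =>
    obtain rfl : j = i := Sum.inr.inj he
    simp [h.lab_out j hi]

theorem removable_iff_of_vtx {d : ProductDart l} {i : Fin l.length} (hd : d.vtx = .inr i)
    (hrot : d.rot ≠ d) : s.Removable (φ d) ↔ Ready G i := by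
  have hgone : φ d ∉ s.gone ↔ i ∉ G := by
    rw [h.gone, hd]
    simp
  have hrot' : T.rot (φ d) ≠ φ d := fun h' => hrot (φ.injective ((hφ.map_rot d).trans h'))
  rw [Stage.Removable, Ready, hgone]
  refine and_congr_right fun hi => ?_
  let inc : {k // l.get i k ≠ k} → T.Dart := fun k => φ (.inc i k.1 k.2)
  have hinj : Function.Injective inc := fun a b hab =>
    Subtype.ext (ProductDart.inc.inj (φ.injective hab)).2
  let B : Set {k // l.get i k ≠ k} :=
    {k | ∀ j hj, Arrow (.out j k.1 hj) (.inc i k.1 k.2) → j ∈ G}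
  have hB : {e | e ∈ star (φ d) ∧ ∃ k, s.lab e k} = inc '' B := by
    ext e
    constructor
    · rintro ⟨he, k, hek⟩
      obtain ⟨hk, rfl, h'⟩ := (h.lab_iff hφ hl hd hi he).1 hek
      exact ⟨⟨k, hk⟩, h', rfl⟩
    · rintro ⟨k, hk, rfl⟩
      exact ⟨(map_mem_star_iff hφ hl).2 hd.symm, k.1, (h.lab_inc i hi _ _ _).2 ⟨rfl, hk⟩⟩
  have hcard : Nat.card {k // l.get i k ≠ k} = (l.get i).support.card := by
    simp [Nat.card_eq_fintype_card, Fintype.card_subtype, Equiv.Perm.support]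
  have hready : (∀ j, Precedes j i → j ∈ G) ↔ B = Set.univ := by
    rw [Set.eq_univ_iff_forall]
    exact ⟨fun h' k j hj ha => h' j ⟨k, hj, k.2, ha⟩,
      fun h' j ⟨k, hj, hk, ha⟩ => h' ⟨k, hk⟩ j hj ha⟩
  rw [hready, Set.eq_univ_iff_ncard, hcard, hB, Set.ncard_image_of_injective _ hinj,
    ncard_star_map hφ hl hd]
  exact ⟨fun ⟨_, _, _, _⟩ => by omega, fun hBi => ⟨hrot', _, rfl, hBi⟩⟩

theorem removable_iff (d : ProductDart l) :
    s.Removable (φ d) ↔ ∃ i, d.vtx = .inr i ∧ Ready G i := by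
  have hleaf : d.rot = d → ¬ s.Removable (φ d) := fun hd hr =>
    hr.2.1 ((hφ.map_rot d).symm.trans (congrArg φ hd))
  cases d with
  | tail k => simpa [vtx] using hleaf rfl
  | head k => simpa [vtx] using hleaf rfl
  | inc i k hk => simpa [vtx] using h.removable_iff_of_vtx hφ hl rfl (by simp [ProductDart.rot])
  | out i k hk => simpa [vtx] using h.removable_iff_of_vtx hφ hl rfl (by simp [ProductDart.rot])

theorem isFactor_get {d : ProductDart l} {i : Fin l.length} (hd : d.vtx = .inr i)
    (hi : Ready G i) : s.IsFactor (φ d) (l.get i) := by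
  have hlab : ∀ k hk, s.lab (φ (.inc i k hk)) k := fun k hk => (h.lab_inc_of_ready hi hk k).2 rfl
  refine ⟨fun e he k hek => ?_, fun k hk => ?_⟩
  · obtain ⟨hk, rfl, -⟩ := (h.lab_iff hφ hl hd hi.1 he).1 hek
    have hrot : ∀ m, T.rot^[m] (φ (.inc i k hk)) = φ (ProductDart.rot^[m] (.inc i k hk)) :=
      fun m => (hφ.map_iterate_rot m _).symm
    refine ⟨2, one_le_two, (hrot 2).symm ▸ hlab _ _, fun q hq hq' k' => ?_⟩
    obtain rfl : q = 1 := by omega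
    exact (hrot 1).symm ▸ h.lab_out i hi.1 _ _ k'
  · by_contra hk'
    exact hk (φ (.inc i k hk')) ((map_mem_star_iff hφ hl).2 hd.symm) (hlab k hk')

theorem eq_get_of_isFactor {d : ProductDart l} {i : Fin l.length} (hd : d.vtx = .inr i)
    (hi : Ready G i) {σ : Equiv.Perm (Fin n)} (hσ : s.IsFactor (φ d) σ) : σ = l.get i := by
  refine hσ.unique (h.isFactor_get hφ hl hd hi) fun e he k k' hk hk' => ?_
  obtain ⟨_, rfl, -⟩ := (h.lab_iff hφ hl hd hi.1 he).1 hk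
  obtain ⟨_, hkk, -⟩ := (h.lab_iff hφ hl hd hi.1 he).1 hk'
  exact (ProductDart.inc.inj (φ.injective hkk)).2

theorem remove {d : ProductDart l} {i : Fin l.length} (hd : d.vtx = .inr i) (hi : Ready G i) :
    Stripped φ (s.remove (φ d)) (insert i G) where
  mem_of_precedes := by
    rintro j _ hj (rfl | hG)
    exacts [.inr (hi.2 j hj), .inr (h.mem_of_precedes _ _ hj hG)]
  gone d' := by
    simp only [Stage.remove, Set.mem_union, h.gone, map_mem_star_iff hφ hl, hd,
      Set.mem_insert_iff, exists_eq_or_imp, or_comm]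
  lab_inc j hj k hk k' := by
    have hjG : j ∉ G := fun h => hj (.inr h)
    rcases arrow_tail_inc_or_exists_arrow_out_inc j k hk with ha | ⟨r, hr, ha⟩
    · have hnot : ∀ r hr, ¬ Arrow (.out r k hr) (.inc j k hk) := fun r hr h' => by
        cases ha.left_unique h'
      rw [remove_lab_iff hφ hl s hd ha.opp_eq', h.lab_inc j hjG]
      simp [vtx, hnot]
    · have hiff : ∀ G' : Set (Fin l.length),
          (∀ q hq, Arrow (.out q k hq) (.inc j k hk) → q ∈ G') ↔ r ∈ G' := fun G' =>
        ⟨fun h' => h' r hr ha, fun h' q hq hqa => by cases ha.left_unique hqa; exact h'⟩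
      rw [remove_lab_iff hφ hl s hd ha.opp_eq', h.lab_inc j hjG, hiff, hiff]
      by_cases hri : r = i
      · subst hri
        simp [vtx, ProductDart.rot, h.lab_inc_of_ready hi]
      · simp [vtx, hri]
  lab_out j hj k hk k' := by
    have hjG : j ∉ G := fun h => hj (.inr h)
    have hnot := h.lab_out j hjG k hk k'
    rcases arrow_out_head_or_exists_arrow_out_inc j k hk with ha | ⟨r, hr, ha⟩
    · rw [remove_lab_iff hφ hl s hd ha.opp_eq]
      simp [vtx, hnot]
    · have hri : r ≠ i := by
        rintro rfl
        exact hjG (hi.2 j ⟨k, hk, hr, ha⟩)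
      rw [remove_lab_iff hφ hl s hd ha.opp_eq]
      simp [vtx, hri, hnot]

theorem complete_iff : s.Complete ↔ G = Set.univ := by
  have hrot : ∀ d, T.rot (φ d) ≠ φ d ↔ d.rot ≠ d := fun d =>
    not_congr ⟨fun h' => φ.injective ((hφ.map_rot d).trans h'),
      fun h' => (hφ.map_rot d).symm.trans (congrArg φ h')⟩
  rw [Set.eq_univ_iff_forall, Stage.Complete, φ.surjective.forall]
  simp only [hrot, h.gone]
  constructor
  · intro hs i
    obtain ⟨k, hk, -⟩ := hl _ (l.get_mem i)
    obtain ⟨j, hj, hji⟩ := hs (.inc i k hk) (by simp [ProductDart.rot])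
    exact Sum.inr.inj hji ▸ hj
  · rintro hG (k | k | ⟨i, k, hk⟩ | ⟨i, k, hk⟩) hd
    exacts [absurd rfl hd, absurd rfl hd, ⟨i, hG i, rfl⟩, ⟨i, hG i, rfl⟩]

theorem step {e : T.Dart} (he : s.Removable e) {σ : Equiv.Perm (Fin n)} (hσ : s.IsFactor e σ) :
    ∃ i, Ready G i ∧ σ = l.get i ∧ Stripped φ (s.remove e) (insert i G) := by
  obtain ⟨d, rfl⟩ := φ.surjective e
  obtain ⟨i, hd, hi⟩ := (h.removable_iff hφ hl d).1 he
  exact ⟨i, hi, h.eq_get_of_isFactor hφ hl hd hi hσ, h.remove hφ hl hd hi⟩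

theorem run {s' : Stage n T} {l' : List (Equiv.Perm (Fin n))} (hrun : Stage.Run s l' s') :
    ∃ G', Stripped φ s' G' ∧
      Relation.EqvGen CommutationMove (remaining G) (l' ++ remaining G') := by
  induction hrun generalizing G with
  | nil s => exact ⟨G, h, .refl _⟩
  | cons s s' e σ l' he hσ _ ih =>
    obtain ⟨i, hi, rfl, hins⟩ := h.step hφ hl he hσ
    obtain ⟨G', hG', heqv⟩ := ih hins
    exact ⟨G', hG', .trans _ _ _ (eqvGen_remaining h.mem_of_precedes hi)
      (CommutationMove.eqvGen_cons _ heqv)⟩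

theorem exists_removable (hs : ¬ s.Complete) : ∃ e, s.Removable e := by
  obtain ⟨i, hi⟩ := exists_ready fun hG => hs ((h.complete_iff hφ hl).2 hG)
  obtain ⟨k, hk, -⟩ := hl _ (l.get_mem i)
  exact ⟨φ (.inc i k hk), (h.removable_iff hφ hl _).2 ⟨i, rfl, hi⟩⟩

theorem exists_isFactor {e : T.Dart} (he : s.Removable e) : ∃ σ, s.IsFactor e σ := by
  obtain ⟨d, rfl⟩ := φ.surjective e
  obtain ⟨i, hd, hi⟩ := (h.removable_iff hφ hl d).1 he
  exact ⟨_, h.isFactor_get hφ hl hd hi⟩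

theorem exists_run : ∃ l' s', Stage.Run s l' s' ∧ s'.Complete := by
  induction G using WellFoundedGT.induction generalizing s with
  | ind G ih =>
    by_cases hs : s.Complete
    · exact ⟨[], s, .nil s, hs⟩
    · obtain ⟨e, he⟩ := h.exists_removable hφ hl hs
      obtain ⟨σ, hσ⟩ := h.exists_isFactor hφ hl he
      obtain ⟨i, hi, -, hins⟩ := h.step hφ hl he hσ
      obtain ⟨l', s', hrun, hs'⟩ := ih _ (Set.ssubset_insert hi.1) hins
      exact ⟨σ :: l', s', .cons _ _ _ _ _ he hσ hrun, hs'⟩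

end Stripped

end Stripped

namespace IsTreeOfProduct

variable {n : ℕ} [NeZero n] {α : ℕ →₀ ℕ} {l : List (Equiv.Perm (Fin n))} {T : PlantedTree}
  (h : T.IsTreeOfProduct l) (hl : IsMinimalFactorization n α l)
include h hl

theorem exists_stripped_initialStage : ∃ φ : ProductDart l ≃ T.Dart,
    IsHom (ProductDart.planeMap l) T.planeMap φ ∧ Stripped φ (initialStage n T) ∅ := by
  obtain ⟨g, hg, hroot⟩ := isTreeOfProduct_iff.1 h
  have hn := h.vertexCount_one hl.isCycle
  exact ⟨g.symm, hg.symm, stripped_initialStage hg.symm hn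
    (map_tail_eq_tailDart hn hl.prod_eq hg.symm (g.symm_apply_eq.2 hroot.symm))⟩

theorem run {l' : List (Equiv.Perm (Fin n))} {s : Stage n T}
    (hrun : Stage.Run (initialStage n T) l' s) :
    (¬ s.Complete → ∃ d, s.Removable d) ∧ (∀ d, s.Removable d → ∃ σ, s.IsFactor d σ) ∧
      (s.Complete → Relation.EqvGen CommutationMove l l') := by
  obtain ⟨φ, hφ, hstrip⟩ := h.exists_stripped_initialStage hl
  obtain ⟨G, hG, heqv⟩ := hstrip.run hφ hl.isCycle hrun
  refine ⟨hG.exists_removable hφ hl.isCycle, fun _ => hG.exists_isFactor hφ hl.isCycle,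
    fun hs => ?_⟩
  rwa [remaining_empty, (hG.complete_iff hφ hl.isCycle).1 hs, remaining_univ,
    List.append_nil] at heqv

theorem eqvGen {l' : List (Equiv.Perm (Fin n))} (h' : T.IsTreeOfProduct l')
    (hl' : IsMinimalFactorization n α l') : Relation.EqvGen CommutationMove l l' := by
  obtain ⟨φ, hφ, hstrip⟩ := h.exists_stripped_initialStage hl
  obtain ⟨l'', s, hrun, hs⟩ := hstrip.exists_run hφ hl.isCycle
  exact .trans _ _ _ ((h.run hl hrun).2.2 hs) (.symm _ _ ((h'.run hl' hrun).2.2 hs))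

end IsTreeOfProduct

end PlantedTree

theorem exists_equiv_inequivalentFactorization (n : ℕ) [NeZero n] (α : ℕ →₀ ℕ) :
    ∃ Φ : InequivalentFactorization n α ≃ {T : PlantedTree // T.HasType n α},
      ∀ (l : MinimalFactorization n α) (T : {T : PlantedTree // T.HasType n α}),
        Φ (Quotient.mk (factorizationSetoid n α) l) = T ↔ T.1.IsTreeOfProduct l.1 := by
  choose tree htree using fun l : MinimalFactorization n α => l.2.exists_isTreeOfProduct
  let F : InequivalentFactorization n α → {T : PlantedTree // T.HasType n α} :=
    Quotient.lift (fun l => ⟨tree l, (htree l).hasType l.2⟩) fun l l' hll' => Subtype.ext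
      (((CommutationMove.isTreeOfProduct_iff_of_eqvGen hll' l.2).1 (htree l)).unique (htree l'))
  have hF : ∀ (l : MinimalFactorization n α) (T : {T : PlantedTree // T.HasType n α}),
      F (Quotient.mk _ l) = T ↔ T.1.IsTreeOfProduct l.1 := fun l T =>
    ⟨fun h => h ▸ htree l, fun h => Subtype.ext ((htree l).unique h)⟩
  have hinj : Function.Injective F := by
    rintro ⟨l⟩ ⟨l'⟩ h
    exact Quotient.sound (((hF l _).1 h).eqvGen l.2 ((hF l' _).1 rfl) l'.2)
  have hsurj : Function.Surjective F := fun T => by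
    obtain ⟨l, hl, hT⟩ := T.2.exists_isTreeOfProduct
    exact ⟨Quotient.mk _ ⟨l, hl⟩, (hF ⟨l, hl⟩ T).2 hT⟩
  exact ⟨Equiv.ofBijective F ⟨hinj, hsurj⟩, hF⟩

/-- Sending a factorization to the plane tree of its product, rooted at the leaf `h₀`, is a bijection
from the equivalence classes of minimal factorizations of type `α` onto the plane trees of type
`α` rooted at a leaf. Its inverse is the stripping procedure: whatever choices have been made, the
procedure can be continued until no internal vertex is left, and then the cycles that have been
read off form a factorization in the class that corresponds to the tree. -/
theorem theorem1 (n : ℕ) [NeZero n] (α : ℕ →₀ ℕ) :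
    ∃ Φ : InequivalentFactorization n α ≃ {T : PlantedTree // T.HasType n α},
      (∀ (l : MinimalFactorization n α) (T : {T : PlantedTree // T.HasType n α}),
        Φ (Quotient.mk (factorizationSetoid n α) l) = T ↔ T.1.IsTreeOfProduct l.1) ∧
      (∀ T : {T : PlantedTree // T.HasType n α}, ∀ l s,
        PlantedTree.Stage.Run (PlantedTree.initialStage n T.1) l s →
          (¬ s.Complete → ∃ d, s.Removable d) ∧
          (∀ d, s.Removable d → ∃ σ, s.IsFactor d σ) ∧
          (s.Complete → ∃ hl : IsMinimalFactorization n α l,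
            Φ.symm T = Quotient.mk (factorizationSetoid n α) ⟨l, hl⟩)) := by
  obtain ⟨Φ, hΦ⟩ := exists_equiv_inequivalentFactorization n α
  refine ⟨Φ, hΦ, fun T l s hrun => ?_⟩
  obtain ⟨l₀, hl₀, hT⟩ := T.2.exists_isTreeOfProduct
  obtain ⟨hremovable, hfactor, hcomplete⟩ := hT.run hl₀ hrun
  refine ⟨hremovable, hfactor, fun hs => ?_⟩
  have heqv := hcomplete hs
  have hl := (CommutationMove.isMinimalFactorization_iff_of_eqvGen heqv).1 hl₀
  have hTl := (CommutationMove.isTreeOfProduct_iff_of_eqvGen heqv hl₀).1 hT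
  exact ⟨hl, Φ.symm_apply_eq.2 ((hΦ ⟨l, hl⟩ T).2 hTl).symm⟩
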